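/- Consider $n$ agents with states $p_i(t),v_i(t)\in\mathbb{R}^m$, $i\in\mathcal N=\{1,\dots,n\}$, governed by $$\dot p_i=v_i,\qquad \dot v_i=F_i(p_i,v_i,u_i),$$ where each $F_i$ is locally Lipschitz and $u_i\in\mathbb{R}^m$ is the input. Let $\mathcal G=(\mathcal N,\mathcal E)$ be a directed graph, where $(j,i)\in\mathcal E$ means that agent $i$ can receive information from agent $j$, and let $A=[a_{ij}]$ be any weighted adjacency matrix of $\mathcal G$: $a_{ii}=0$, $a_{ij}>0$ if $(j,i)\in\mathcal E$, $a_{ij}=0$ otherwise. Put $\kappa_i=\sum_j a_{ij}$ and $\mathcal N^\sharp=\{i:\kappa_i\ne0\}$. *Communication.* Let $T>0$. The message sent by $j$ to $i$, $(j,i)\in\mathcal E$, at time $kT$ ($k=0,1,2,\dots$) has delay $\tau^{(j,i)}_k\in[0,+\infty]$, where $+\infty$ means that it is not sent or is lost. Assume that there are $k^*\in\mathbb N$ and $h\ge0$ such that for every $(j,i)\in\mathcal E$ there is an infinite strictly increasing sequence of indices $k_0<k_1<\cdots$ in $\{0,1,2,\dots\}$ with $k_0\le k^*$, $k_{l+1}-k_l\le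 k^*$ and $\tau^{(j,i)}_{k_l}\le h$ for all $l\ge 0$. Put $h^*=k^*T+h$ and $k_{ij}(t)=\max\{k\ge 0:\ kT+\tau^{(j,i)}_k\le t\}$. *Tracking control laws.* Each agent uses a static or dynamic control law $u_i$, a function of time, of an internal state $\xi_i$ governed by an ordinary differential equation, of $p_i,v_i$, and of a reference velocity $v_{r_i}$ and its derivative $\dot v_{r_i}$, such that for every $v_{r_i}\in\mathcal C^1([0,\infty);\mathbb{R}^m)$ and along every trajectory on $[0,\infty)$ of agent $i$ under this law, the error $e_i=v_i-v_{r_i}$ is bounded on $[0,\infty)$, and $e_i(t)\to0$ as $t\to+\infty$ if $v_{r_i}$ and $\dot v_{r_i}$ are bounded on $[0,\infty)$. *Reference velocities.* Let $v_d\in\mathbb{R}^m$ be a constant desired velocity known to all agents, and let $v_{r_i}=\eta_i+v_d$, where $\eta_i\equiv0$ for $i\notin\mathcal N^\sharp$ and, for $i\in\mathcal N^\sharp$, $$\dot\eta_i=-k_i^\eta\eta_i-\lambda_i(p_i-\psi_i),\qquad \dot\psi_i=-\psi_i+v_d+\frac1{\kappa_i}\sum_{j:(j,i)\in\mathcal E}a_{ij}\,p^{(i)}_j(t),$$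 $$p^{(i)}_j(t)=p_j(k_{ij}(t)T)+v_d\,(t-k_{ij}(t)T),$$ with gains $k_i^\eta,\lambda_i>0$; before the first message of $j$ has reached $i$, $p^{(i)}_j(t)$ is an arbitrary signal. For $i\in\mathcal N^\sharp$ let $\mu_i=-\max(\mathrm{Re}\,\mu_{i,1},\mathrm{Re}\,\mu_{i,2})$, where $\mu_{i,1},\mu_{i,2}$ are the roots of $x^2+k_i^\eta x+\lambda_i=0$, and suppose that $$\mu_i>1+2h^*\qquad\text{for all } i\in\mathcal N^\sharp .$$ If $\mathcal G$ contains a spanning tree (some node has a directed path to every other node), then for every trajectory on $[0,\infty)$ of the closed-loop network, whatever its initial conditions, $v_i(t)\to v_d$ and $p_i(t)-p_j(t)\to0$ as $t\to+\infty$ for all $i,j\in\mathcal N$. -/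

import Mathlib

open Filter Topology MeasureTheory Set
open scoped ENNReal

noncomputable section

namespace MultiAgent

/-- Vectors of `ℝᵐ` with the Euclidean norm. -/
abbrev Vec (m : ℕ) := EuclideanSpace ℝ (Fin m)

/-- `x` is a (Carathéodory) solution of `ẋ(t) = g(t)` on `[0, ∞)`: `g` is locally integrable there
and `x` is its primitive. Where `g` is continuous this is the classical derivative. -/
def SolvesODE {E : Type*} [NormedAddCommGroup E] [NormedSpace ℝ E] (x g : ℝ → E) : Prop :=
  ∀ t : ℝ, 0 ≤ t → IntervalIntegrable g volume 0 t ∧ x t = x 0 + ∫ s in (0 : ℝ)..t, g s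

/-- `x` is uniformly bounded on `[0, ∞)`. -/
def BoundedForward {E : Type*} [NormedAddCommGroup E] (x : ℝ → E) : Prop :=
  ∃ B : ℝ, ∀ t : ℝ, 0 ≤ t → ‖x t‖ ≤ B

/-! ### Tracking control laws -/

/-- A static (`q = 0`) or dynamic control law for one agent: an internal state `ξ ∈ ℝ^q` with
`ξ̇ = dynamics t ξ p v v_r v̇_r`, and the input `u = output t ξ p v v_r v̇_r`. -/
structure TrackingLaw (m : ℕ) where
  /-- dimension of the internal state -/
  q : ℕ
  /-- right-hand side of the equation of the internal state -/
  dynamics : ℝ → Vec q → Vec m → Vec m → Vec m → Vec m → Vec q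
  /-- the control input -/
  output : ℝ → Vec q → Vec m → Vec m → Vec m → Vec m → Vec m

/-- `v_r` is continuously differentiable on `[0, ∞)`, with derivative `dvr`. -/
def IsC1Reference {m : ℕ} (vr dvr : ℝ → Vec m) : Prop :=
  (∀ t : ℝ, 0 ≤ t → HasDerivWithinAt vr (dvr t) (Ici 0) t) ∧ ContinuousOn dvr (Ici 0)

/-- `(p, v, ξ)` is a trajectory on `[0, ∞)` of the agent `ṗ = v`, `v̇ = F(p, v, u)` driven by the
control law `law` with reference velocity `vr` and its derivative `dvr`. -/
structure IsAgentTrajectory {m : ℕ} (F : Vec m → Vec m → Vec m → Vec m) (law : TrackingLaw m)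
    (vr dvr p v : ℝ → Vec m) (ξ : ℝ → Vec law.q) : Prop where
  position : SolvesODE p v
  velocity : SolvesODE v
    (fun t => F (p t) (v t) (law.output t (ξ t) (p t) (v t) (vr t) (dvr t)))
  internal : SolvesODE ξ (fun t => law.dynamics t (ξ t) (p t) (v t) (vr t) (dvr t))

/-- The control law tracks reference velocities: for each `C¹` reference velocity and each
trajectory (with arbitrary initial condition), the error `e = v - v_r` is uniformly bounded, and it
tends to zero if `v_r` and `v̇_r` are uniformly bounded. -/
def TrackingLaw.Tracks {m : ℕ} (law : TrackingLaw m) (F : Vec m → Vec m → Vec m → Vec m) : Prop :=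
  ∀ vr dvr : ℝ → Vec m, IsC1Reference vr dvr →
    ∀ (p v : ℝ → Vec m) (ξ : ℝ → Vec law.q), IsAgentTrajectory F law vr dvr p v ξ →
      BoundedForward (fun t => v t - vr t) ∧
      (BoundedForward vr → BoundedForward dvr →
        Tendsto (fun t => v t - vr t) atTop (𝓝 0))

/-! ### The graph -/

/-- The directed graph contains a spanning tree: some node has a directed path to all others.
`G.Adj j i` means that `(j, i)` is an edge, i.e. that `i` can receive information from `j`. -/
def HasSpanningTree {n : ℕ} (G : Digraph (Fin n)) : Prop :=
  ∃ r : Fin n, ∀ i : Fin n, Relation.ReflTransGen G.Adj r i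

/-- `a` is a weighted adjacency matrix of `G`. -/
structure IsWeightedAdjacency {n : ℕ} (G : Digraph (Fin n)) (a : Fin n → Fin n → ℝ) : Prop where
  diag : ∀ i, a i i = 0
  pos : ∀ i j, G.Adj j i → 0 < a i j
  zero : ∀ i j, ¬ G.Adj j i → a i j = 0

/-- `κ_i = ∑_j a_ij`; agent `i` has an incoming link iff `κ_i ≠ 0`. -/
def kappa {n : ℕ} (a : Fin n → Fin n → ℝ) (i : Fin n) : ℝ := ∑ j, a i j

/-! ### The communication process -/

/-- The communication process: `τ j i k ∈ [0, ∞]` is the delay of the message that agent `j` sends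
to agent `i` at time `k T`. For each edge `(j, i)`, a sequence of sampling indices starts at most
at `kstar`, has gaps at most `kstar`, and carries messages with delay at most `h`. -/
def CommunicationAssumption {n : ℕ} (G : Digraph (Fin n)) (τ : Fin n → Fin n → ℕ → ℝ≥0∞)
    (kstar : ℕ) (h : ℝ) : Prop :=
  ∀ j i : Fin n, G.Adj j i → ∃ K : ℕ → ℕ, StrictMono K ∧ K 0 ≤ kstar ∧
    (∀ l, K (l + 1) - K l ≤ kstar) ∧ ∀ l, τ j i (K l) ≤ ENNReal.ofReal h

/-- Indices of the messages of one link that have been delivered by time `t ≥ 0`. -/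
def delivered (T : ℝ) (τ : ℕ → ℝ≥0∞) (t : ℝ) : Set ℕ :=
  {k | ENNReal.ofReal (k * T) + τ k ≤ ENNReal.ofReal t}

/-- The index of the most recent delivered message. For `T > 0` the set is bounded, so that this is
its maximum as soon as it is nonempty. -/
def lastIndex (T : ℝ) (τ : ℕ → ℝ≥0∞) (t : ℝ) : ℕ := sSup (delivered T τ t)

open Classical in
/-- The estimate, at the receiver, of the current position of the sender, whose position is `p`:
`p(k(t) T) + (t - k(t) T) v_d` where `k(t)` is the index of the most recent delivered message. As
long as nothing has been delivered, it is an arbitrary signal `init`. -/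
def posEstimate {m : ℕ} (T : ℝ) (τ : ℕ → ℝ≥0∞) (vd : Vec m) (init p : ℝ → Vec m) (t : ℝ) :
    Vec m :=
  if (delivered T τ t).Nonempty then
    p (lastIndex T τ t * T) + (t - lastIndex T τ t * T) • vd
  else init t

/-! ### The closed loop -/

/-- `-max (Re μ₁) (Re μ₂)` where `μ₁`, `μ₂` are the complex roots of `x² + k x + lam`. -/
def rootMargin (k lam : ℝ) : ℝ :=
  -sSup (Complex.re '' {x : ℂ | x ^ 2 + (k : ℂ) * x + (lam : ℂ) = 0})

open Classical in
/-- The derivative of the synchronization term: `-k η - lam (p - ψ)` if agent `i` has an incoming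
link, and zero otherwise. -/
def etaRate {n m : ℕ} (a : Fin n → Fin n → ℝ) (k lam : Fin n → ℝ) (p η ψ : Fin n → ℝ → Vec m)
    (i : Fin n) (t : ℝ) : Vec m :=
  if kappa a i ≠ 0 then -(k i • η i t) - lam i • (p i t - ψ i t) else 0

/-- `(p, v, ξ, η, ψ)` is a trajectory on `[0, ∞)` of the whole network: each agent is driven by its
control law with reference velocity `v_r = η + v_d`, where `η` vanishes for an agent without
incoming links and is otherwise generated, together with `ψ`, by the synchronization filter. -/
structure IsNetworkTrajectory {n m : ℕ} (F : Fin n → Vec m → Vec m → Vec m → Vec m)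
    (law : Fin n → TrackingLaw m) (a : Fin n → Fin n → ℝ) (T : ℝ) (τ : Fin n → Fin n → ℕ → ℝ≥0∞)
    (k lam : Fin n → ℝ) (vd : Vec m) (init : Fin n → Fin n → ℝ → Vec m)
    (p v η ψ : Fin n → ℝ → Vec m) (ξ : (i : Fin n) → ℝ → Vec (law i).q) : Prop where
  agent : ∀ i, IsAgentTrajectory (F i) (law i) (fun t => η i t + vd) (etaRate a k lam p η ψ i)
    (p i) (v i) (ξ i)
  eta : ∀ i, kappa a i ≠ 0 → SolvesODE (η i) (etaRate a k lam p η ψ i)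
  psi : ∀ i, kappa a i ≠ 0 → SolvesODE (ψ i) (fun t => -ψ i t + vd +
    (1 / kappa a i) • ∑ j, a i j • posEstimate T (τ j i) vd (init i j) (p j) t)
  eta_zero : ∀ i, kappa a i = 0 → ∀ t : ℝ, 0 ≤ t → η i t = 0

end MultiAgent

end

/-!
Why the network synchronizes. In coordinates moving with the desired velocity put
`q_i = p_i - t v_d`, `φ_i = ψ_i - t v_d` and `e_i = v_i - η_i - v_d`. An agent with incoming links
then obeys the linear system `q̇ = η + e`, `η̇ = -k η - lam (q - φ)`, `φ̇ = -φ + u`, where `u` is a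
weighted average of delayed positions `q_j`. Up to a disturbance governed by `e`, the position `q`
is therefore the convolution of `u` with the impulse response `γ` of
`lam / ((s² + k s + lam) (s + 1))`.

The gain condition enters only through `rootMargin > 1`, that is, `k > 2` and `lam > k - 1`. Under
this condition `γ` is a probability density: `exp x * γ x` is the distance of a damped oscillator,
released at rest, from its initial displacement, and this is nonnegative because the energy
decreases (`exists_oscillator_bound`, `exists_filter_kernel`). So each agent forms a weighted mean
of past positions, whatever the delays. An agent without incoming links fits into the same scheme,
with a self-loop and the kernel `exp (-x)` (`exists_leader_kernel`).

The consensus argument (`IsAveragingScheme.exists_contraction`) is a maximum principle. The state of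
the network at time `t` is said to be at most `M` if the positions on `[t - H, t]` are at most `M`
and the free responses are at most those of the equilibrium `M`. By positivity such a bound persists.
The shortfall of the input of the root below `M` during one unit of time spreads along the paths of
the spanning tree to all agents within a fixed time, which lowers the bound by a fixed fraction of
that shortfall. The same holds for lower bounds, and the two shortfalls add up to the width of the
interval between the bounds. Hence the width contracts, up to a multiple of the disturbance.

All estimates have the form of an asymptotic gain: if the errors `e` are eventually at most `ε`,
then the disagreement and the filter states are eventually at most `C ε`, with `C` independent of
`ε` (`IsNetworkTrajectory.exists_gain`). This is used twice. The tracking laws make `e` bounded,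
hence the reference velocities and their derivatives are bounded; then the tracking laws give
`e → 0`, hence the disagreement and all `η_i` tend to zero.
-/

section

/-! ### Kernels with a positive impulse response -/

/-- Every planar linear system with constant coefficients has a global solution with prescribed
initial value. -/
theorem exists_planar_linear_solution (p₁ p₂ p₃ p₄ a₀ b₀ : ℝ) :
    ∃ a b : ℝ → ℝ, a 0 = a₀ ∧ b 0 = b₀ ∧
      (∀ x, HasDerivAt a (p₁ * a x + p₂ * b x) x) ∧
      (∀ x, HasDerivAt b (p₃ * a x + p₄ * b x) x) := by
  let A : (ℝ × ℝ) →L[ℝ] (ℝ × ℝ) :=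
    (p₁ • ContinuousLinearMap.fst ℝ ℝ ℝ + p₂ • ContinuousLinearMap.snd ℝ ℝ ℝ).prod
      (p₃ • ContinuousLinearMap.fst ℝ ℝ ℝ + p₄ • ContinuousLinearMap.snd ℝ ℝ ℝ)
  let Y : ℝ → ℝ × ℝ := fun x => NormedSpace.exp (x • A) (a₀, b₀)
  have hY : ∀ x, HasDerivAt Y (A (Y x)) x := fun x => by
    have := (hasDerivAt_exp_smul_const' (𝕂 := ℝ) A x).clm_apply (hasDerivAt_const x (a₀, b₀))
    simpa using this
  refine ⟨fun x => (Y x).1, fun x => (Y x).2, by simp [Y], by simp [Y], fun x => ?_, fun x => ?_⟩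
  · exact ((ContinuousLinearMap.fst ℝ ℝ ℝ).hasFDerivAt.comp_hasDerivAt x (hY x)).congr_deriv
      (by simp [A])
  · exact ((ContinuousLinearMap.snd ℝ ℝ ℝ).hasFDerivAt.comp_hasDerivAt x (hY x)).congr_deriv
      (by simp [A])

/-- An impulse response `g` together with its tail integral `tail y = ∫ x in y..∞, g x`: `g` is a
probability density on `[0, ∞)` which is comparable with `exp (-x)` away from `0`. -/
structure IsPositiveKernel (g tail : ℝ → ℝ) : Prop where
  cont : Continuous g
  nonneg : ∀ x, 0 ≤ x → 0 ≤ g x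
  tail_zero : tail 0 = 1
  hasDerivAt_tail : ∀ x, HasDerivAt tail (-g x) x
  upper : ∃ C, ∀ x, 0 ≤ x → g x ≤ C * Real.exp (-x) ∧ |tail x| ≤ C * Real.exp (-x)
  lower : ∃ ρ, 0 < ρ ∧ ∀ x, 1 ≤ x → ρ * Real.exp (-x) ≤ g x

theorem isPositiveKernel_exp_neg :
    IsPositiveKernel (fun x => Real.exp (-x)) (fun x => Real.exp (-x)) where
  cont := by fun_prop
  nonneg x _ := (Real.exp_pos _).le
  tail_zero := by simp
  hasDerivAt_tail x := by simpa using (hasDerivAt_neg x).exp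
  upper := ⟨1, fun x _ => by simp⟩
  lower := ⟨1, one_pos, fun x _ => by simp⟩

/-- A damped oscillator at rest at time `0` has strictly lost energy at time `1`, hence never
swings back to its initial displacement. -/
theorem exists_oscillator_bound {c d Y₀ : ℝ} (hc : 0 < c) (hd : 0 < d) (hY : 0 < Y₀) {y z : ℝ → ℝ}
    (hy0 : y 0 = Y₀) (hz0 : z 0 = 0) (hy : ∀ x, HasDerivAt y (z x) x)
    (hz : ∀ x, HasDerivAt z (-(d * y x) - c * z x) x) :
    (∀ x, 0 ≤ x → y x ^ 2 ≤ Y₀ ^ 2 ∧ z x ^ 2 ≤ d * Y₀ ^ 2) ∧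
      ∃ Y₁, Y₁ < Y₀ ∧ ∀ x, 1 ≤ x → y x ≤ Y₁ := by
  set E : ℝ → ℝ := fun x => z x ^ 2 + d * y x ^ 2 with hE
  have hE' : ∀ x, HasDerivAt E (-(2 * c * z x ^ 2)) x := fun x => by
    have := ((hz x).pow 2).add (((hy x).pow 2).const_mul d)
    refine this.congr_deriv ?_
    push_cast
    ring
  have hanti : Antitone E := antitone_of_hasDerivAt_nonpos hE' fun x => by
    have : 0 ≤ 2 * c * z x ^ 2 := by positivity
    simpa using this
  have hE0 : E 0 = d * Y₀ ^ 2 := by simp [hE, hy0, hz0]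
  have hlt : E 1 < E 0 := by
    refine lt_of_le_of_ne (hanti zero_le_one) fun heq => ?_
    -- a conserved energy on `[0, 1]` forces `z = 0` there, hence `y = 0`
    have hconst : ∀ x ∈ Ioo (0 : ℝ) 1, E x = E 0 := fun x hx =>
      le_antisymm (hanti hx.1.le) (heq ▸ hanti hx.2.le)
    have hz' : ∀ x ∈ Ioo (0 : ℝ) 1, z x = 0 := fun x hx => by
      have h1 : HasDerivAt E 0 x := (hasDerivAt_const x (E 0)).congr_of_eventuallyEq
        (Filter.eventually_of_mem (Ioo_mem_nhds hx.1 hx.2) hconst)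
      have h2 := (hE' x).unique h1
      have : z x ^ 2 = 0 := by
        have : c * z x ^ 2 = 0 := by linarith
        exact (mul_eq_zero.1 this).resolve_left hc.ne'
      exact pow_eq_zero_iff (two_ne_zero) |>.1 this
    have hmem : (1 / 2 : ℝ) ∈ Ioo (0 : ℝ) 1 := by norm_num
    have h3 : HasDerivAt z 0 (1 / 2) := (hasDerivAt_const _ (0 : ℝ)).congr_of_eventuallyEq
      (Filter.eventually_of_mem (Ioo_mem_nhds hmem.1 hmem.2) hz')
    have h4 := (hz (1 / 2)).unique h3
    rw [hz' _ hmem] at h4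
    have h5 : y (1 / 2) = 0 := by
      have : d * y (1 / 2) = 0 := by linarith
      exact (mul_eq_zero.1 this).resolve_left hd.ne'
    have h6 := hconst _ hmem
    rw [hE0] at h6
    simp only [hE, h5, hz' _ hmem] at h6
    have : 0 < d * Y₀ ^ 2 := by positivity
    norm_num at h6
    rcases h6 with h6 | h6 <;> linarith
  refine ⟨fun x hx => ?_, √(E 1 / d), ?_, fun x hx => ?_⟩
  · have h1 := hanti hx
    rw [hE0] at h1
    simp only [hE] at h1
    have h2 : d * y x ^ 2 ≤ d * Y₀ ^ 2 := by nlinarith [sq_nonneg (z x)]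
    exact ⟨le_of_mul_le_mul_left h2 hd, by nlinarith [mul_nonneg hd.le (sq_nonneg (y x))]⟩
  · rw [Real.sqrt_lt' hY, div_lt_iff₀ hd]
    linarith
  · refine Real.le_sqrt_of_sq_le ?_
    rw [le_div_iff₀ hd]
    have h1 := hanti hx
    simp only [hE] at h1 ⊢
    nlinarith [sq_nonneg (z x)]

/-- If the roots of `s² + k s + lam` have real part less than `-1`, then the impulse response `γ` of
`lam / ((s² + k s + lam) (s + 1))` is positive. The functions `α`, `β`, `γ` are the components of
the row vector `(1, 0, 0) exp (x A)`, where `A` is the matrix of the synchronization filter. -/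
theorem exists_filter_kernel {k lam : ℝ} (hk : 2 < k) (hlam : k - 1 < lam) :
    ∃ α β γ : ℝ → ℝ, α 0 = 1 ∧ β 0 = 0 ∧ γ 0 = 0 ∧
      (∀ x, HasDerivAt α (-(lam * β x)) x) ∧ (∀ x, HasDerivAt β (α x - k * β x) x) ∧
      (∀ x, HasDerivAt γ (lam * β x - γ x) x) ∧
      (∃ C, ∀ x, 0 ≤ x → |α x| ≤ C * Real.exp (-x) ∧ |β x| ≤ C * Real.exp (-x)) ∧
      IsPositiveKernel γ (fun x => α x + γ x) := by
  -- after multiplication with `exp x` the filter becomes an oscillator with damping `c` and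
  -- stiffness `d`, and `γ` becomes its (nonnegative) distance to the initial displacement
  set c := k - 2 with hc
  set d := lam - k + 1 with hd
  have hc0 : 0 < c := by linarith
  have hd0 : 0 < d := by linarith
  have hlam0 : 0 < lam := by linarith
  obtain ⟨y, z, hy0, hz0, hy, hz⟩ := exists_planar_linear_solution 0 1 (-d) (-c) (lam / d) 0
  have hy' : ∀ x, HasDerivAt y (z x) x := fun x => (hy x).congr_deriv (by ring)
  have hz' : ∀ x, HasDerivAt z (-(d * y x) - c * z x) x := fun x => (hz x).congr_deriv (by ring)
  have hY0 : 0 < lam / d := by positivity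
  obtain ⟨hbd, Y₁, hY₁, hlow⟩ := exists_oscillator_bound hc0 hd0 hY0 hy0 hz0 hy' hz'
  have hexp : ∀ x : ℝ, HasDerivAt (fun x => Real.exp (-x)) (-Real.exp (-x)) x := fun x => by
    simpa using (hasDerivAt_neg x).exp
  have hyb : ∀ x, 0 ≤ x → |y x| ≤ lam / d := fun x hx => abs_le_of_sq_le_sq (hbd x hx).1 hY0.le
  have hzb : ∀ x, 0 ≤ x → |z x| ≤ √d * (lam / d) := fun x hx => by
    refine abs_le_of_sq_le_sq ?_ (by positivity)
    rw [mul_pow, Real.sq_sqrt hd0.le]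
    exact (hbd x hx).2
  set Z := √d * (lam / d) with hZ
  have hZ0 : 0 ≤ Z := by positivity
  set α : ℝ → ℝ := fun x => Real.exp (-x) * ((d * y x - z x) / lam) with hα
  set β : ℝ → ℝ := fun x => Real.exp (-x) * (-z x / lam) with hβ
  set γ : ℝ → ℝ := fun x => Real.exp (-x) * (lam / d - y x) with hγ
  have hαd : ∀ x, HasDerivAt α (-(lam * β x)) x := fun x => by
    refine ((hexp x).mul ((((hy' x).const_mul d).sub (hz' x)).div_const lam)).congr_deriv ?_
    simp only [hβ, hc, hd, Pi.sub_apply]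
    field_simp
    ring
  have hβd : ∀ x, HasDerivAt β (α x - k * β x) x := fun x => by
    refine ((hexp x).mul (((hz' x).neg).div_const lam)).congr_deriv ?_
    simp only [hα, hβ, hc, hd, Pi.neg_apply]
    field_simp
    ring
  have hγd : ∀ x, HasDerivAt γ (lam * β x - γ x) x := fun x => by
    refine ((hexp x).mul ((hy' x).const_sub (lam / d))).congr_deriv ?_
    simp only [hβ, hγ]
    field_simp
    ring
  have hαb : ∀ x, 0 ≤ x → |α x| ≤ (1 + Z / lam) * Real.exp (-x) := fun x hx => by
    simp only [hα]
    rw [abs_mul, Real.abs_exp, mul_comm]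
    gcongr
    have hsplit : (1 + Z / lam) * lam = lam + Z := by field_simp
    rw [abs_div, abs_of_pos hlam0, div_le_iff₀ hlam0, hsplit]
    refine (abs_sub _ _).trans (add_le_add ?_ (hzb x hx))
    rw [abs_mul, abs_of_pos hd0]
    calc d * |y x| ≤ d * (lam / d) := by gcongr; exact hyb x hx
      _ = lam := by field_simp
  have hβb : ∀ x, 0 ≤ x → |β x| ≤ (1 + Z / lam) * Real.exp (-x) := fun x hx => by
    simp only [hβ]
    rw [abs_mul, Real.abs_exp, mul_comm]
    gcongr
    have hsplit : (1 + Z / lam) * lam = lam + Z := by field_simp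
    rw [abs_div, abs_of_pos hlam0, div_le_iff₀ hlam0, hsplit, abs_neg]
    linarith [hzb x hx]
  have hγb : ∀ x, 0 ≤ x → |γ x| ≤ 2 * (lam / d) * Real.exp (-x) := fun x hx => by
    simp only [hγ]
    rw [abs_mul, Real.abs_exp, mul_comm]
    gcongr
    have := hyb x hx
    rw [abs_le] at this ⊢
    constructor <;> linarith [this.1, this.2]
  refine ⟨α, β, γ, ?_, ?_, ?_, hαd, hβd, hγd, ⟨_, fun x hx => ⟨hαb x hx, hβb x hx⟩⟩, ?_, ?_, ?_, ?_,
    ?_, ?_⟩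
  · simp only [hα, hy0, hz0]
    field_simp
    simp
  · simp [hβ, hz0]
  · simp [hγ, hy0]
  · exact continuous_iff_continuousAt.2 fun x => (hγd x).continuousAt
  · intro x hx
    exact mul_nonneg (Real.exp_pos _).le (by linarith [le_of_abs_le (hyb x hx)])
  · simp only [hα, hγ, hy0, hz0]
    field_simp
    simp
  · intro x
    exact ((hαd x).add (hγd x)).congr_deriv (by ring)
  · refine ⟨(1 + Z / lam) + 2 * (lam / d), fun x hx => ⟨?_, ?_⟩⟩
    · have : 0 ≤ (1 + Z / lam) * Real.exp (-x) := by positivity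
      linarith [le_of_abs_le (hγb x hx)]
    · linarith [hγb x hx, hαb x hx, abs_add_le (α x) (γ x)]
  · refine ⟨lam / d - Y₁, by linarith, fun x hx => ?_⟩
    simp only [hγ]
    rw [mul_comm]
    gcongr
    exact hlow x hx

namespace IsPositiveKernel

variable {g tail : ℝ → ℝ}

theorem integral_eq (hg : IsPositiveKernel g tail) (s y b c : ℝ) :
    ∫ x in b..c, g (s + y - x) = tail (s + y - c) - tail (s + y - b) := by
  have hd : ∀ x ∈ uIcc b c, HasDerivAt (fun x => tail (s + y - x)) (g (s + y - x)) x :=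
    fun x _ => by
      exact ((hg.hasDerivAt_tail (s + y - x)).comp x
        ((hasDerivAt_id x).const_sub (s + y))).congr_deriv (by simp)
  refine intervalIntegral.integral_eq_sub_of_hasDerivAt hd ?_
  exact (hg.cont.comp (by fun_prop)).intervalIntegrable _ _

theorem antitoneOn_tail (hg : IsPositiveKernel g tail) : AntitoneOn tail (Ici 0) := by
  refine antitoneOn_of_hasDerivWithinAt_nonpos (f' := fun x => -g x) (convex_Ici 0)
    (fun x _ => (hg.hasDerivAt_tail x).continuousAt.continuousWithinAt)
    (fun x _ => (hg.hasDerivAt_tail x).hasDerivWithinAt) fun x hx => ?_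
  rw [interior_Ici] at hx
  linarith [hg.nonneg x (mem_Ioi.1 hx).le]

theorem tendsto_tail (hg : IsPositiveKernel g tail) : Tendsto tail atTop (𝓝 0) := by
  obtain ⟨C, hC⟩ := hg.upper
  refine squeeze_zero_norm' (a := fun x => C * Real.exp (-x)) ?_ ?_
  · filter_upwards [eventually_ge_atTop 0] with x hx using (hC x hx).2
  · simpa using (Real.tendsto_exp_neg_atTop_nhds_zero).const_mul C

theorem le_tail (hg : IsPositiveKernel g tail) :
    ∃ r, 0 < r ∧ ∀ y, 0 ≤ y → r * Real.exp (-y) ≤ tail y := by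
  obtain ⟨ρ, hρ, hlow⟩ := hg.lower
  refine ⟨ρ * Real.exp (-1), by positivity, fun y hy => ?_⟩
  -- on `[1, ∞)` the difference `tail x - ρ * exp (-x)` decreases to `0`
  have hd : ∀ x : ℝ, HasDerivAt (fun x => tail x - ρ * Real.exp (-x))
      (-g x + ρ * Real.exp (-x)) x := fun x =>
    ((hg.hasDerivAt_tail x).sub (((hasDerivAt_neg x).exp).const_mul ρ)).congr_deriv (by ring)
  have hanti : AntitoneOn (fun x => tail x - ρ * Real.exp (-x)) (Ici 1) := by
    refine antitoneOn_of_hasDerivWithinAt_nonpos (convex_Ici 1)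
      (fun x _ => (hd x).continuousAt.continuousWithinAt)
      (fun x _ => (hd x).hasDerivWithinAt) fun x hx => ?_
    rw [interior_Ici] at hx
    linarith [hlow x (mem_Ioi.1 hx).le]
  have hlim : Tendsto (fun x => tail x - ρ * Real.exp (-x)) atTop (𝓝 0) := by
    simpa using hg.tendsto_tail.sub ((Real.tendsto_exp_neg_atTop_nhds_zero).const_mul ρ)
  have h1 : 0 ≤ tail (y + 1) - ρ * Real.exp (-(y + 1)) := by
    refine le_of_tendsto hlim ?_
    filter_upwards [eventually_ge_atTop (y + 1)] with x hx
    exact hanti (mem_Ici.2 (by linarith)) (mem_Ici.2 (by linarith)) hx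
  have h2 : tail (y + 1) ≤ tail y :=
    hg.antitoneOn_tail (mem_Ici.2 hy) (mem_Ici.2 (by linarith)) (by linarith)
  have h3 : Real.exp (-(y + 1)) = Real.exp (-1) * Real.exp (-y) := by
    rw [← Real.exp_add]; ring_nf
  rw [h3] at h1
  linarith

theorem tail_pos (hg : IsPositiveKernel g tail) {y : ℝ} (hy : 0 ≤ y) : 0 < tail y := by
  obtain ⟨r, hr, h⟩ := hg.le_tail
  exact lt_of_lt_of_le (by positivity) (h y hy)

end IsPositiveKernel

section Averaging

/-! ### Delayed averaging with positive kernels -/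

/-- The response at time `t + y` to the input `u` on `[0, t]`, the input being switched off after
time `t`. -/
noncomputable def freeResponse (g u : ℝ → ℝ) (t y : ℝ) : ℝ := ∫ s in (0 : ℝ)..t, g (t + y - s) * u s

theorem freeResponse_neg (g u : ℝ → ℝ) (t y : ℝ) :
    freeResponse g (fun s => -u s) t y = -freeResponse g u t y := by
  simp [freeResponse]

theorem intervalIntegrable_kernel_mul {g u : ℝ → ℝ} (hg : Continuous g) {b c : ℝ}
    (hu : IntervalIntegrable u volume b c) (t : ℝ) :
    IntervalIntegrable (fun x => g (t - x) * u x) volume b c :=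
  hu.continuousOn_mul (by fun_prop)

theorem freeResponse_split {g u : ℝ → ℝ} (hg : Continuous g) {t s : ℝ} (ht : 0 ≤ t) (hts : t ≤ s)
    (hu : IntervalIntegrable u volume 0 s) (y : ℝ) :
    freeResponse g u s y =
      freeResponse g u t (s - t + y) + ∫ x in t..s, g (s + y - x) * u x := by
  have h1 : IntervalIntegrable u volume 0 t :=
    hu.mono_set (by rw [uIcc_of_le ht, uIcc_of_le (ht.trans hts)]; exact Icc_subset_Icc_right hts)
  have h2 : IntervalIntegrable u volume t s :=
    hu.mono_set (by rw [uIcc_of_le hts, uIcc_of_le (ht.trans hts)]; exact Icc_subset_Icc_left ht)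
  have h3 : ∀ x, t + (s - t + y) - x = s + y - x := fun x => by ring
  simp only [freeResponse, h3]
  exact (intervalIntegral.integral_add_adjacent_intervals
    (intervalIntegrable_kernel_mul hg h1 _) (intervalIntegrable_kernel_mul hg h2 _)).symm

variable {ι : Type*} [Fintype ι]

/-- The fixed data of a network of averaging agents: `w` is a stochastic matrix, the information
that `i` uses about `j` at time `s` dates from the time `σ i j s ∈ [s - H, s]`, and agent `i`
filters its input with the positive kernel `g i`. -/
structure IsAveragingScheme (w : ι → ι → ℝ) (σ : ι → ι → ℝ → ℝ) (g tail : ι → ℝ → ℝ) (H : ℝ) :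
    Prop where
  delay_nonneg : 0 ≤ H
  weight_nonneg : ∀ i j, 0 ≤ w i j
  weight_sum : ∀ i, ∑ j, w i j = 1
  delay : ∀ i j s, H ≤ s → σ i j s ∈ Icc (s - H) s
  kernel : ∀ i, IsPositiveKernel (g i) (tail i)

/-- The outputs `q i` of the network: `q i` is the filtered input `u i` up to the disturbance
`d i`, and from time `H` on `u i` is the weighted average of the delayed outputs. -/
structure IsAveragingSolution (w : ι → ι → ℝ) (σ : ι → ι → ℝ → ℝ) (g : ι → ℝ → ℝ) (H : ℝ)
    (q u d : ι → ℝ → ℝ) : Prop where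
  cont : ∀ i, ContinuousOn (q i) (Ici 0)
  integrable : ∀ i t, 0 ≤ t → IntervalIntegrable (u i) volume 0 t
  average : ∀ i s, H ≤ s → u i s = ∑ j, w i j * q j (σ i j s)
  response : ∀ i t, 0 ≤ t → q i t = freeResponse (g i) (u i) t 0 + d i t

/-- The state of the network at time `t`, that is, the outputs on `[t - H, t]` and the free
responses, is at most that of the equilibrium in which all outputs are equal to `M`. -/
structure StateLE (g tail : ι → ℝ → ℝ) (H : ℝ) (q u : ι → ℝ → ℝ) (t M : ℝ) : Prop where
  window : ∀ i, ∀ s ∈ Icc (t - H) t, q i s ≤ M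
  response : ∀ i y, 0 ≤ y → freeResponse (g i) (u i) t y ≤ M * tail i y

variable {w : ι → ι → ℝ} {σ : ι → ι → ℝ → ℝ} {g tail : ι → ℝ → ℝ} {H : ℝ} {q u d : ι → ℝ → ℝ}

theorem IsAveragingSolution.neg (hS : IsAveragingSolution w σ g H q u d) :
    IsAveragingSolution w σ g H (fun i t => -q i t) (fun i t => -u i t) (fun i t => -d i t) where
  cont i := (hS.cont i).neg
  integrable i t ht := (hS.integrable i t ht).neg
  average i s hs := by simp [hS.average i s hs]
  response i t ht := by
    rw [freeResponse_neg, hS.response i t ht]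
    ring

theorem StateLE.mono (hN : IsAveragingScheme w σ g tail H) {t M M' : ℝ} (hMM' : M ≤ M')
    (h : StateLE g tail H q u t M) : StateLE g tail H q u t M' where
  window i s hs := (h.window i s hs).trans hMM'
  response i y hy := (h.response i y hy).trans
    (mul_le_mul_of_nonneg_right hMM' ((hN.kernel i).tail_pos hy).le)

theorem IsAveragingScheme.input_le (hN : IsAveragingScheme w σ g tail H)
    (hS : IsAveragingSolution w σ g H q u d) {t s M : ℝ} (ht : H ≤ t) (hts : t ≤ s)
    (hM : ∀ i, ∀ x ∈ Icc (t - H) s, q i x ≤ M) (i : ι) : u i s ≤ M := by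
  rw [hS.average i s (ht.trans hts)]
  calc ∑ j, w i j * q j (σ i j s) ≤ ∑ j, w i j * M := by
        refine Finset.sum_le_sum fun j _ => mul_le_mul_of_nonneg_left ?_ (hN.weight_nonneg i j)
        have := hN.delay i j s (ht.trans hts)
        exact hM j _ ⟨by linarith [this.1], this.2⟩
    _ = M := by rw [← Finset.sum_mul, hN.weight_sum, one_mul]

theorem IsAveragingSolution.integrable_of_le (hS : IsAveragingSolution w σ g H q u d) (i : ι)
    {b c : ℝ} (hb : 0 ≤ b) (hbc : b ≤ c) : IntervalIntegrable (u i) volume b c :=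
  (hS.integrable i c (hb.trans hbc)).mono_set
    (by rw [uIcc_of_le hbc, uIcc_of_le (hb.trans hbc)]; exact Icc_subset_Icc_left hb)

/-- The shortfall of the free response below the equilibrium `M` is at least the filtered shortfall
of the input over any time interval `[b, c] ⊆ [t, s]`. -/
theorem IsAveragingScheme.integral_le_shortfall (hN : IsAveragingScheme w σ g tail H)
    (hS : IsAveragingSolution w σ g H q u d) {t s b c y M : ℝ} (ht : H ≤ t) (htb : t ≤ b)
    (hbc : b ≤ c) (hcs : c ≤ s) (hy : 0 ≤ y) (hM : ∀ i, ∀ x ∈ Icc (t - H) s, q i x ≤ M)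
    (i : ι) (hresp : ∀ y, 0 ≤ y → freeResponse (g i) (u i) t y ≤ M * tail i y) :
    ∫ x in b..c, g i (s + y - x) * (M - u i x) ≤
      M * tail i y - freeResponse (g i) (u i) s y := by
  have ht0 : 0 ≤ t := hN.delay_nonneg.trans ht
  have hts : t ≤ s := htb.trans (hbc.trans hcs)
  have hk := hN.kernel i
  have hu : IntervalIntegrable (u i) volume t s := hS.integrable_of_le i ht0 hts
  have hint : IntervalIntegrable (fun x => g i (s + y - x) * (M - u i x)) volume t s :=
    intervalIntegrable_kernel_mul hk.cont (intervalIntegrable_const.sub hu) _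
  have h1 : ∫ x in b..c, g i (s + y - x) * (M - u i x) ≤
      ∫ x in t..s, g i (s + y - x) * (M - u i x) := by
    refine intervalIntegral.integral_mono_interval htb hbc hcs ?_ hint
    filter_upwards [ae_restrict_mem measurableSet_Ioc] with x hx
    have h2 : u i x ≤ M := hN.input_le hS ht hx.1.le
      (fun j z hz => hM j z ⟨hz.1, hz.2.trans hx.2⟩) i
    exact mul_nonneg (hk.nonneg _ (by linarith [hx.2])) (by linarith)
  have h2 : ∫ x in t..s, g i (s + y - x) * (M - u i x) =
      (tail i y - tail i (s - t + y)) * M - ∫ x in t..s, g i (s + y - x) * u i x := by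
    have h3 := hk.integral_eq s y t s
    rw [show s + y - s = y by ring, show s + y - t = s - t + y by ring] at h3
    simp only [mul_sub]
    rw [intervalIntegral.integral_sub
      (intervalIntegrable_kernel_mul hk.cont intervalIntegrable_const _)
      (intervalIntegrable_kernel_mul hk.cont hu _), intervalIntegral.integral_mul_const, h3]
  rw [freeResponse_split hk.cont ht0 hts (hS.integrable i s (ht0.trans hts)) y]
  have h4 := hresp (s - t + y) (by linarith)
  linarith

/-- Over a time span of length `B` the outputs overshoot an upper bound of the state by at most a
multiple of the disturbance. -/
theorem IsAveragingScheme.exists_overshoot_bound (hN : IsAveragingScheme w σ g tail H) {B : ℝ}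
    (hB : 0 ≤ B) :
    ∃ K, 0 ≤ K ∧ ∀ q u d, IsAveragingSolution w σ g H q u d → ∀ t ε M, H ≤ t → 0 ≤ ε →
      StateLE g tail H q u t M → (∀ i, ∀ s ∈ Icc t (t + B), d i s ≤ ε) →
      ∀ i, ∀ s ∈ Icc (t - H) (t + B), q i s ≤ M + K * ε := by
  have hpos : ∀ i, 0 < tail i B := fun i => (hN.kernel i).tail_pos hB
  refine ⟨∑ i, (tail i B)⁻¹, Finset.sum_nonneg fun i _ => (inv_pos.2 (hpos i)).le,
    fun q u d hS t ε M ht hε hM hd => ?_⟩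
  have hK : ∀ i, ε ≤ tail i B * ((∑ i, (tail i B)⁻¹) * ε) := fun i => by
    have h1 : (tail i B)⁻¹ ≤ ∑ i, (tail i B)⁻¹ :=
      Finset.single_le_sum (fun j _ => (inv_pos.2 (hpos j)).le) (Finset.mem_univ i)
    calc ε = tail i B * ((tail i B)⁻¹ * ε) := by field_simp [(hpos i).ne']
      _ ≤ _ := by gcongr; exact (hpos i).le
  set K := ∑ i, (tail i B)⁻¹ with hKdef
  have hK0 : 0 ≤ K := Finset.sum_nonneg fun i _ => (inv_pos.2 (hpos i)).le
  have hKε : 0 ≤ K * ε := by positivity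
  have ht0 : 0 ≤ t := hN.delay_nonneg.trans ht
  intro i₀ s₀ hs₀
  have : Nonempty ι := ⟨i₀⟩
  -- the largest value over all agents and the time span
  have hmax : ∀ i, ∃ s ∈ Icc t (t + B), ∀ x ∈ Icc t (t + B), q i x ≤ q i s := fun i =>
    isCompact_Icc.exists_isMaxOn ⟨t, by simp [hB]⟩
      ((hS.cont i).mono fun x hx => mem_Ici.2 (ht0.trans hx.1))
  choose S hS_mem hS_max using hmax
  obtain ⟨j, hj⟩ := Finite.exists_max (fun i => q i (S i))
  have hle : ∀ i, ∀ x ∈ Icc t (t + B), q i x ≤ q j (S j) := fun i x hx =>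
    (hS_max i x hx).trans (hj i)
  suffices hF : q j (S j) ≤ M + K * ε by
    rcases le_total s₀ t with h | h
    · linarith [hM.window i₀ s₀ ⟨hs₀.1, h⟩]
    · exact (hle i₀ s₀ ⟨h, hs₀.2⟩).trans hF
  by_contra! hcon
  have hMF : M ≤ q j (S j) := by linarith
  have hSj := hS_mem j
  have hwin : ∀ i, ∀ x ∈ Icc (t - H) (S j), q i x ≤ q j (S j) := fun i x hx => by
    rcases le_total x t with h | h
    · exact (hM.window i x ⟨hx.1, h⟩).trans hMF
    · exact hle i x ⟨h, hx.2.trans hSj.2⟩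
  have hk := hN.kernel j
  have hsplit := freeResponse_split hk.cont ht0 hSj.1 (hS.integrable j _ (ht0.trans hSj.1)) 0
  have hq := hS.response j _ (ht0.trans hSj.1)
  have hresp := hM.response j (S j - t + 0) (by linarith [hSj.1])
  have hint : ∫ x in t..S j, g j (S j + 0 - x) * u j x ≤
      (1 - tail j (S j - t + 0)) * q j (S j) := by
    have h3 := hk.integral_eq (S j) 0 t (S j)
    rw [show S j + 0 - S j = 0 by ring, show S j + 0 - t = S j - t + 0 by ring, hk.tail_zero] at h3
    rw [← h3, ← intervalIntegral.integral_mul_const]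
    refine intervalIntegral.integral_mono_on hSj.1
      (intervalIntegrable_kernel_mul hk.cont (hS.integrable_of_le j ht0 hSj.1) _)
      (intervalIntegrable_kernel_mul hk.cont intervalIntegrable_const _) fun x hx => ?_
    exact mul_le_mul_of_nonneg_left (hN.input_le hS ht hx.1
      (fun i z hz => hwin i z ⟨hz.1, hz.2.trans hx.2⟩) j) (hk.nonneg _ (by linarith [hx.2]))
  have hdj := hd j _ hSj
  have hgap : (q j (S j) - M) * tail j (S j - t + 0) ≤ ε := by linarith
  have htail : tail j B ≤ tail j (S j - t + 0) :=
    hk.antitoneOn_tail (mem_Ici.2 (by linarith [hSj.1])) (mem_Ici.2 hB) (by linarith [hSj.2])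
  have h5 : tail j B * (K * ε) < tail j B * (q j (S j) - M) :=
    mul_lt_mul_of_pos_left (by linarith) (hpos j)
  have h6 : (q j (S j) - M) * tail j B ≤ (q j (S j) - M) * tail j (S j - t + 0) :=
    mul_le_mul_of_nonneg_left htail (by linarith)
  linarith [hK j]

/-- Over the time span `[t, t + B]` the disturbance is at most `ε` and the outputs are at most `M`,
as they are on `[t - H, t]`; the free responses at time `t` are at most those of the equilibrium
`M`. -/
structure IsDominated (g tail : ι → ℝ → ℝ) (H : ℝ) (q u d : ι → ℝ → ℝ) (t B ε M : ℝ) : Prop where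
  disturbance : ∀ i, ∀ s ∈ Icc t (t + B), d i s ≤ ε
  window : ∀ i, ∀ s ∈ Icc (t - H) (t + B), q i s ≤ M
  response : ∀ i y, 0 ≤ y → freeResponse (g i) (u i) t y ≤ M * tail i y

/-- If the shortfall of the input is at least `X` on `[b, c]`, then so is, up to a constant factor,
the shortfall of the free response at later times. -/
theorem IsAveragingScheme.mul_le_shortfall (hN : IsAveragingScheme w σ g tail H)
    (hS : IsAveragingSolution w σ g H q u d) {t B ε M s b y X r : ℝ} (ht : H ≤ t)
    (hdom : IsDominated g tail H q u d t B ε M) (htb : t ≤ b) (hbs : b + 1 ≤ s) (hsB : s ≤ t + B)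
    (hy : 0 ≤ y) (i : ι) (hX : 0 ≤ X) (hu : ∀ x ∈ Icc b (b + 1), X ≤ M - u i x)
    (hr : ∀ x ∈ Icc b (b + 1), r ≤ g i (s + y - x)) :
    r * X ≤ M * tail i y - freeResponse (g i) (u i) s y := by
  have hk := hN.kernel i
  have ht0 : 0 ≤ t := hN.delay_nonneg.trans ht
  refine le_trans ?_ (hN.integral_le_shortfall hS ht htb (by linarith : b ≤ b + 1) hbs hy
    (fun j x hx => hdom.window j x ⟨hx.1, hx.2.trans hsB⟩) i (hdom.response i))
  have h1 : ∫ _ in b..(b + 1), r * X = r * X := by simp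
  rw [← h1]
  refine intervalIntegral.integral_mono_on (by linarith) intervalIntegrable_const
    (intervalIntegrable_kernel_mul hk.cont (intervalIntegrable_const.sub
      (hS.integrable_of_le i (ht0.trans htb) (by linarith))) _) fun x hx => ?_
  exact mul_le_mul (hr x hx) (hu x hx) hX (hk.nonneg _ (by linarith [hx.2]))

/-- A shortfall of the input of the root `r` during `[t, t + 1]` reaches every agent `j` to which
there is a path from `r`. -/
theorem IsAveragingScheme.exists_shortfall_of_path (hN : IsAveragingScheme w σ g tail H) {r j : ι}
    (hpath : Relation.ReflTransGen (fun j i => 0 < w i j) r j) :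
    ∃ a, 0 ≤ a ∧ ∀ B, ∃ θ K, 0 < θ ∧ 0 ≤ K ∧ ∀ q u d, IsAveragingSolution w σ g H q u d →
      ∀ t ε M, H ≤ t → 0 ≤ ε → IsDominated g tail H q u d t B ε M →
      ∀ s ∈ Icc (t + a) (t + B),
        θ * (∫ x in t..(t + 1), (M - u r x)) - K * ε ≤ M - q j s := by
  induction hpath with
  | refl =>
    refine ⟨2, by norm_num, fun B => ?_⟩
    have hk := hN.kernel r
    obtain ⟨ρ, hρ, hlow⟩ := hk.lower
    refine ⟨ρ * Real.exp (-B), 1, by positivity, zero_le_one,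
      fun q u d hS t ε M ht hε hdom s hs => ?_⟩
    have ht0 : 0 ≤ t := hN.delay_nonneg.trans ht
    have h1 := hN.integral_le_shortfall hS ht le_rfl (by linarith : t ≤ t + 1)
      (by linarith [hs.1] : t + 1 ≤ s) le_rfl
      (fun j x hx => hdom.window j x ⟨hx.1, hx.2.trans hs.2⟩) r (hdom.response r)
    have h2 : ρ * Real.exp (-B) * (∫ x in t..(t + 1), (M - u r x)) ≤
        ∫ x in t..(t + 1), g r (s + 0 - x) * (M - u r x) := by
      rw [← intervalIntegral.integral_const_mul]
      have hint : IntervalIntegrable (fun x => M - u r x) volume t (t + 1) :=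
        intervalIntegrable_const.sub (hS.integrable_of_le r ht0 (by linarith))
      refine intervalIntegral.integral_mono_on (by linarith) (hint.const_mul _)
        (intervalIntegrable_kernel_mul hk.cont hint _) fun x hx => ?_
      refine mul_le_mul_of_nonneg_right ?_ ?_
      · refine le_trans ?_ (hlow _ (by linarith [hx.2, hs.1]))
        gcongr
        linarith [hx.1, hs.2]
      · have := hN.input_le hS ht hx.1
          (fun j z hz => hdom.window j z ⟨hz.1, by linarith [hz.2, hx.2, hs.1, hs.2]⟩) r
        linarith
    have h3 := hS.response r s (by linarith [hs.1])
    have h4 := hdom.disturbance r s ⟨by linarith [hs.1], hs.2⟩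
    rw [hk.tail_zero] at h1
    linarith
  | @tail j i _ hji ih =>
    obtain ⟨a, ha, ih⟩ := ih
    have hH := hN.delay_nonneg
    refine ⟨a + H + 2, by linarith, fun B => ?_⟩
    obtain ⟨θ, K, hθ, hK, ih⟩ := ih B
    have hk := hN.kernel i
    obtain ⟨ρ, hρ, hlow⟩ := hk.lower
    refine ⟨ρ * Real.exp (-B) * (w i j * θ), ρ * Real.exp (-B) * (w i j * K) + 1, by positivity,
      by positivity, fun q u d hS t ε M ht hε hdom s hs => ?_⟩
    have ht0 : 0 ≤ t := hN.delay_nonneg.trans ht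
    set J := ∫ x in t..(t + 1), (M - u r x) with hJ
    have hin : ∀ x ∈ Icc (t + a + H) (t + a + H + 1),
        max 0 (w i j * (θ * J - K * ε)) ≤ M - u i x := fun x hx => by
      have hxB : x ≤ t + B := by linarith [hx.2, hs.1, hs.2]
      refine max_le ?_ ?_
      · have := hN.input_le hS ht (by linarith [hx.1] : t ≤ x)
          (fun l z hz => hdom.window l z ⟨hz.1, hz.2.trans hxB⟩) i
        linarith
      · have hσ : ∀ l, σ i l x ∈ Icc (x - H) x := fun l => hN.delay i l x (by linarith [hx.1])
        have h1 : M - u i x = ∑ l, w i l * (M - q l (σ i l x)) := by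
          simp only [mul_sub, Finset.sum_sub_distrib, ← Finset.sum_mul, hN.weight_sum, one_mul]
          rw [hS.average i x (by linarith [hx.1])]
        rw [h1]
        have h2 : w i j * (M - q j (σ i j x)) ≤ ∑ l, w i l * (M - q l (σ i l x)) :=
          Finset.single_le_sum (f := fun l => w i l * (M - q l (σ i l x)))
            (fun l _ => mul_nonneg (hN.weight_nonneg i l) (by
              have := hdom.window l (σ i l x)
                ⟨by linarith [(hσ l).1, hx.1], (hσ l).2.trans hxB⟩
              linarith)) (Finset.mem_univ j)
        refine le_trans ?_ h2
        exact mul_le_mul_of_nonneg_left (ih q u d hS t ε M ht hε hdom _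
          ⟨by linarith [(hσ j).1, hx.1], (hσ j).2.trans hxB⟩) hji.le
    have h1 := hN.mul_le_shortfall hS ht hdom (by linarith : t ≤ t + a + H)
      (by linarith [hs.1] : t + a + H + 1 ≤ s) hs.2 le_rfl i (le_max_left _ _) hin
      (r := ρ * Real.exp (-B)) fun x hx => by
        refine le_trans ?_ (hlow _ (by linarith [hx.2, hs.1]))
        gcongr
        linarith [hx.1, hs.2]
    have h2 : ρ * Real.exp (-B) * (w i j * (θ * J - K * ε)) ≤
        ρ * Real.exp (-B) * max 0 (w i j * (θ * J - K * ε)) := by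
      gcongr
      exact le_max_right _ _
    have h3 := hS.response i s (by linarith [hs.1])
    have h4 := hdom.disturbance i s ⟨by linarith [hs.1], hs.2⟩
    rw [hk.tail_zero] at h1
    linarith

/-! ### Contraction of the disagreement -/

/-- In a fixed time an upper bound `M` of the state is improved by a fixed fraction of its distance
to the mean input of the root. -/
theorem IsAveragingScheme.exists_contraction (hN : IsAveragingScheme w σ g tail H) {r : ι}
    (hpath : ∀ i, Relation.ReflTransGen (fun j i => 0 < w i j) r i) :
    ∃ Θ θ K, 1 ≤ Θ ∧ 0 < θ ∧ θ ≤ 1 ∧ 0 ≤ K ∧ ∀ q u d, IsAveragingSolution w σ g H q u d →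
      ∀ t ε M, H ≤ t → 0 ≤ ε → StateLE g tail H q u t M →
      (∀ i, ∀ s ∈ Icc t (t + Θ), d i s ≤ ε) →
      StateLE g tail H q u (t + Θ) (M - θ * (M - ∫ x in t..(t + 1), u r x) + K * ε) ∧
        ∀ i, ∀ s ∈ Icc (t - H) (t + Θ), q i s ≤ M + K * ε := by
  have : Nonempty ι := ⟨r⟩
  have hH := hN.delay_nonneg
  choose a ha hreach using fun i => hN.exists_shortfall_of_path (hpath i)
  set A := ∑ i, a i with hA
  have haA : ∀ i, a i ≤ A := fun i => Finset.single_le_sum (fun j _ => ha j) (Finset.mem_univ i)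
  have hA0 : 0 ≤ A := Finset.sum_nonneg fun i _ => ha i
  set Θ := A + H + 2 with hΘ
  choose θ' K' hθ' hK' hreach using fun i => hreach i Θ
  obtain ⟨i₁, hi₁⟩ := Finite.exists_min θ'
  obtain ⟨K₁, hK₁, hover⟩ := hN.exists_overshoot_bound (B := Θ) (by linarith)
  choose ρ hρ hlow using fun i => (hN.kernel i).lower
  choose C hC using fun i => (hN.kernel i).upper
  have hC1 : ∀ i, 1 ≤ C i := fun i => by
    have := (hC i 0 le_rfl).2
    rw [(hN.kernel i).tail_zero] at this
    simpa using this
  obtain ⟨i₂, hi₂⟩ := Finite.exists_min fun i => ρ i * Real.exp (-2) / C i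
  set θ₀ := min (θ' i₁) 1 with hθ₀
  set c := min (ρ i₂ * Real.exp (-2) / C i₂) 1 with hc
  have hθ₀0 : 0 < θ₀ := lt_min (hθ' _) one_pos
  have hc0 : 0 < c := lt_min
    (div_pos (mul_pos (hρ _) (Real.exp_pos _)) (by linarith [hC1 i₂])) one_pos
  have hc1 : c ≤ 1 := min_le_right _ _
  have hcC : ∀ i, c * C i ≤ ρ i * Real.exp (-2) := fun i => by
    rw [← le_div_iff₀ (by linarith [hC1 i])]
    exact (min_le_left _ _).trans (hi₂ i)
  set K₀ := ∑ i, K' i with hK₀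
  have hK₀0 : 0 ≤ K₀ := Finset.sum_nonneg fun i _ => hK' i
  refine ⟨Θ, c * θ₀, K₁ + K₀, by linarith, by positivity,
    mul_le_one₀ hc1 hθ₀0.le (min_le_right _ _), by positivity,
    fun q u d hS t ε M ht hε hM hd => ?_⟩
  have ht0 : 0 ≤ t := hH.trans ht
  have hq := hover q u d hS t ε M ht hε hM hd
  set M' := M + K₁ * ε with hM'
  have hMM' : M ≤ M' := by
    have : 0 ≤ K₁ * ε := by positivity
    linarith
  have hdom : IsDominated g tail H q u d t Θ ε M' := ⟨hd, hq, (hM.mono hN hMM').response⟩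
  set J := ∫ x in t..(t + 1), (M' - u r x) with hJ
  have hJeq : J = M' - ∫ x in t..(t + 1), u r x := by
    rw [hJ, intervalIntegral.integral_sub intervalIntegrable_const
      (hS.integrable_of_le r ht0 (by linarith))]
    simp
  have hin : ∀ i, ∀ x ∈ Icc t (t + Θ), u i x ≤ M' := fun i x hx =>
    hN.input_le hS ht hx.1 (fun j z hz => hq j z ⟨hz.1, hz.2.trans hx.2⟩) i
  have hJ0 : 0 ≤ J := by
    refine intervalIntegral.integral_nonneg (by linarith) fun x hx => ?_
    linarith [hin r x ⟨hx.1, by linarith [hx.2]⟩]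
  set X := max 0 (θ₀ * J - K₀ * ε) with hX
  have hX0 : 0 ≤ X := le_max_left _ _
  have hshort : ∀ i, ∀ s ∈ Icc (t + A) (t + Θ), X ≤ M' - q i s := fun i s hs => by
    refine max_le (by linarith [hq i s ⟨by linarith [hs.1], hs.2⟩]) ?_
    refine le_trans ?_ (hreach i q u d hS t ε M' ht hε hdom s ⟨by linarith [hs.1, haA i], hs.2⟩)
    have h1 : θ₀ * J ≤ θ' i * J :=
      mul_le_mul_of_nonneg_right ((min_le_left _ _).trans (hi₁ i)) hJ0
    have h2 : K' i * ε ≤ K₀ * ε := mul_le_mul_of_nonneg_right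
      (Finset.single_le_sum (fun j _ => hK' j) (Finset.mem_univ i)) hε
    linarith
  have hcX : c * X ≤ X := mul_le_of_le_one_left hX0 hc1
  refine ⟨StateLE.mono hN (M := M' - c * X) ?_ ⟨fun i s hs => ?_, fun i y hy => ?_⟩,
    fun i s hs => ?_⟩
  · have h1 : c * (θ₀ * J - K₀ * ε) ≤ c * X := by gcongr; exact le_max_right _ _
    have h2 : c * (K₀ * ε) ≤ K₀ * ε := mul_le_of_le_one_left (by positivity) hc1
    have h3 : 0 ≤ c * (θ₀ * (M' - M)) :=
      mul_nonneg hc0.le (mul_nonneg hθ₀0.le (by linarith))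
    rw [hJeq] at h1
    linarith
  · linarith [hshort i s ⟨by linarith [hs.1], hs.2⟩]
  · have hexp : Real.exp (-(y + 2)) = Real.exp (-2) * Real.exp (-y) := by
      rw [← Real.exp_add]; ring_nf
    have h1 := hN.mul_le_shortfall hS (b := t + Θ - 2) (s := t + Θ) (X := X)
      (r := ρ i * Real.exp (-(y + 2))) ht hdom (by linarith) (by linarith) le_rfl hy i hX0
      (fun x hx => by
        rw [hS.average i x (by linarith [hx.1])]
        have h2 : ∑ j, w i j * q j (σ i j x) ≤ ∑ j, w i j * (M' - X) := by
          refine Finset.sum_le_sum fun j _ => mul_le_mul_of_nonneg_left ?_ (hN.weight_nonneg i j)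
          have h3 := hN.delay i j x (by linarith [hx.1])
          linarith [hshort j (σ i j x) ⟨by linarith [h3.1, hx.1], by linarith [h3.2, hx.2]⟩]
        rw [← Finset.sum_mul, hN.weight_sum, one_mul] at h2
        linarith)
      (fun x hx => by
        refine le_trans ?_ (hlow i _ (by linarith [hx.2]))
        have := (hρ i).le
        gcongr
        linarith [hx.1])
    have h2 : c * X * tail i y ≤ ρ i * Real.exp (-(y + 2)) * X := by
      have h3 : tail i y ≤ C i * Real.exp (-y) := (le_abs_self _).trans (hC i y hy).2
      calc c * X * tail i y ≤ c * X * (C i * Real.exp (-y)) := by gcongr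
        _ = c * C i * (X * Real.exp (-y)) := by ring
        _ ≤ ρ i * Real.exp (-2) * (X * Real.exp (-y)) := 
            mul_le_mul_of_nonneg_right (hcC i) (by positivity)
        _ = _ := by rw [hexp]; ring
    linarith
  · have : 0 ≤ K₀ * ε := by positivity
    linarith [hq i s hs]

theorem IsAveragingScheme.exists_stateLE (hN : IsAveragingScheme w σ g tail H)
    (hS : IsAveragingSolution w σ g H q u d) {t : ℝ} (ht : H ≤ t) :
    ∃ M, StateLE g tail H q u t M := by
  have ht0 : 0 ≤ t := hN.delay_nonneg.trans ht
  have h1 : ∀ i, ∃ b, 0 ≤ b ∧ ∀ s ∈ Icc (t - H) t, q i s ≤ b := fun i => by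
    obtain ⟨b, hb⟩ := (isCompact_Icc (a := t - H) (b := t)).bddAbove_image
      ((hS.cont i).mono fun x hx => mem_Ici.2 (by linarith [hx.1]))
    exact ⟨max b 0, le_max_right _ _, fun s hs => (hb (mem_image_of_mem _ hs)).trans
      (le_max_left _ _)⟩
  have h2 : ∀ i, ∃ b, 0 ≤ b ∧ ∀ y, 0 ≤ y → freeResponse (g i) (u i) t y ≤ b * tail i y := fun i => by
    have hk := hN.kernel i
    obtain ⟨C, hC⟩ := hk.upper
    obtain ⟨ρ, hρ, hlow⟩ := hk.le_tail
    have hu := hS.integrable i t ht0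
    have hC0 : 0 ≤ C := by
      have := (hk.nonneg 0 le_rfl).trans (hC 0 le_rfl).1
      simpa using this
    have hI : 0 ≤ ∫ x in (0 : ℝ)..t, |u i x| :=
      intervalIntegral.integral_nonneg ht0 fun x _ => abs_nonneg _
    refine ⟨C / ρ * ∫ x in (0 : ℝ)..t, |u i x|, by positivity, fun y hy => ?_⟩
    calc freeResponse (g i) (u i) t y
        ≤ ∫ x in (0 : ℝ)..t, C * Real.exp (-y) * |u i x| := by
          refine intervalIntegral.integral_mono_on ht0 (intervalIntegrable_kernel_mul hk.cont hu _)
            (hu.abs.const_mul _) fun x hx => ?_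
          have h3 := hk.nonneg (t + y - x) (by linarith [hx.2])
          have h4 : g i (t + y - x) ≤ C * Real.exp (-y) := by
            refine (hC _ (by linarith [hx.2])).1.trans ?_
            gcongr
            linarith [hx.2]
          calc g i (t + y - x) * u i x ≤ g i (t + y - x) * |u i x| := by
                gcongr; exact le_abs_self _
            _ ≤ _ := by gcongr
      _ = C / ρ * (∫ x in (0 : ℝ)..t, |u i x|) * (ρ * Real.exp (-y)) := by
          rw [intervalIntegral.integral_const_mul]
          field_simp
      _ ≤ _ := by
          gcongr
          exact hlow y hy
  choose b₁ hb₁ hq using h1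
  choose b₂ hb₂ hr using h2
  have hs₁ : ∀ i, b₁ i ≤ ∑ j, b₁ j := fun i =>
    Finset.single_le_sum (fun j _ => hb₁ j) (Finset.mem_univ i)
  have hs₂ : ∀ i, b₂ i ≤ ∑ j, b₂ j := fun i =>
    Finset.single_le_sum (fun j _ => hb₂ j) (Finset.mem_univ i)
  have hp₁ : 0 ≤ ∑ j, b₁ j := Finset.sum_nonneg fun j _ => hb₁ j
  have hp₂ : 0 ≤ ∑ j, b₂ j := Finset.sum_nonneg fun j _ => hb₂ j
  refine ⟨∑ i, b₁ i + ∑ i, b₂ i, fun i s hs => ?_, fun i y hy => ?_⟩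
  · linarith [hq i s hs, hs₁ i]
  · refine (hr i y hy).trans (mul_le_mul_of_nonneg_right ?_ ((hN.kernel i).tail_pos hy).le)
    linarith [hs₂ i]

/-- The disagreement of the outputs is eventually bounded by a fixed multiple of the disturbance. -/
theorem IsAveragingScheme.exists_disagreement_gain (hN : IsAveragingScheme w σ g tail H) {r : ι}
    (hpath : ∀ i, Relation.ReflTransGen (fun j i => 0 < w i j) r i) :
    ∃ C, 0 < C ∧ ∀ q u d, IsAveragingSolution w σ g H q u d → ∀ ε, 0 < ε →
      (∀ᶠ t in atTop, ∀ i, |d i t| ≤ ε) →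
      ∀ᶠ t in atTop, ∀ i j, ∀ s ∈ Icc (t - H) t, |q i t - q j s| ≤ C * ε := by
  obtain ⟨Θ, θ, K, hΘ, hθ, hθ1, hK, hstep⟩ := hN.exists_contraction hpath
  refine ⟨1 + 2 * K / θ + 2 * K, by positivity, fun q u d hS ε hε hd => ?_⟩
  obtain ⟨T₁, hT₁⟩ := eventually_atTop.1 hd
  set T₀ := max T₁ H with hT₀
  have hT₀H : H ≤ T₀ := le_max_right _ _
  have hdT : ∀ t, T₀ ≤ t → ∀ i, |d i t| ≤ ε := fun t ht => hT₁ t ((le_max_left _ _).trans ht)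
  have htk : ∀ k : ℕ, T₀ ≤ T₀ + k * Θ := fun k => by
    have : 0 ≤ (k : ℝ) * Θ := by positivity
    linarith
  have hup : ∀ k : ℕ, ∀ i, ∀ s ∈ Icc (T₀ + k * Θ) (T₀ + k * Θ + Θ), d i s ≤ ε := fun k i s hs =>
    (le_abs_self _).trans (hdT s ((htk k).trans hs.1) i)
  have hdn : ∀ k : ℕ, ∀ i, ∀ s ∈ Icc (T₀ + k * Θ) (T₀ + k * Θ + Θ), -d i s ≤ ε := fun k i s hs =>
    (neg_le_abs _).trans (hdT s ((htk k).trans hs.1) i)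
  obtain ⟨M₀, hM₀⟩ := hN.exists_stateLE hS hT₀H
  obtain ⟨m₀, hm₀⟩ := hN.exists_stateLE hS.neg hT₀H
  set W := |M₀ + m₀| with hW
  -- `M` and `-m` are an upper and a lower bound of the state
  have hseq : ∀ k : ℕ, ∃ M m, StateLE g tail H q u (T₀ + k * Θ) M ∧
      StateLE g tail H (fun i t => -q i t) (fun i t => -u i t) (T₀ + k * Θ) m ∧
      M + m ≤ (1 - θ) ^ k * W + 2 * K / θ * ε := fun k => by
    induction k with
    | zero =>
      refine ⟨M₀, m₀, by simpa using hM₀, by simpa using hm₀, ?_⟩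
      have : 0 ≤ 2 * K / θ * ε := by positivity
      linarith [le_abs_self (M₀ + m₀)]
    | succ k ih =>
      obtain ⟨M, m, hM, hm, hMm⟩ := ih
      have h1 := (hstep q u d hS _ ε M (hT₀H.trans (htk k)) hε.le hM (hup k)).1
      have h2 := (hstep _ _ _ hS.neg _ ε m (hT₀H.trans (htk k)) hε.le hm (hdn k)).1
      rw [show T₀ + k * Θ + Θ = T₀ + (k + 1 : ℕ) * Θ by push_cast; ring] at h1 h2
      refine ⟨_, _, h1, h2, ?_⟩
      rw [intervalIntegral.integral_neg]
      have h3 : (1 - θ) * (M + m) ≤ (1 - θ) * ((1 - θ) ^ k * W + 2 * K / θ * ε) :=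
        mul_le_mul_of_nonneg_left hMm (by linarith)
      have h4 : (1 - θ) * (2 * K / θ * ε) = 2 * K / θ * ε - 2 * K * ε := by field_simp
      rw [mul_add _ (_ ^ k * W), h4] at h3
      rw [pow_succ]
      linarith
  have hlim : Tendsto (fun k : ℕ => (1 - θ) ^ k * W) atTop (𝓝 0) := by
    simpa using (tendsto_pow_atTop_nhds_zero_of_lt_one (by linarith : (0 : ℝ) ≤ 1 - θ)
      (by linarith)).mul_const W
  obtain ⟨k₀, hk₀⟩ := eventually_atTop.1 (hlim.eventually_le_const hε)
  filter_upwards [eventually_ge_atTop (T₀ + k₀ * Θ)] with t ht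
  have hΘ0 : 0 < Θ := by linarith
  have htT : 0 ≤ (t - T₀) / Θ := div_nonneg (by linarith [htk k₀]) hΘ0.le
  set k := ⌊(t - T₀) / Θ⌋₊ with hk
  have hk₀k : k₀ ≤ k := Nat.le_floor (by rw [le_div_iff₀ hΘ0]; linarith)
  have hlo : T₀ + k * Θ ≤ t := by
    have := Nat.floor_le htT
    rw [le_div_iff₀ hΘ0] at this
    linarith
  have hhi : t ≤ T₀ + k * Θ + Θ := by
    have := (Nat.lt_floor_add_one ((t - T₀) / Θ)).le
    rw [div_le_iff₀ hΘ0] at this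
    linarith
  obtain ⟨M, m, hM, hm, hMm⟩ := hseq k
  have h1 := (hstep q u d hS _ ε M (hT₀H.trans (htk k)) hε.le hM (hup k)).2
  have h2 := (hstep _ _ _ hS.neg _ ε m (hT₀H.trans (htk k)) hε.le hm (hdn k)).2
  have h3 := hk₀ k hk₀k
  have hmem : ∀ s ∈ Icc (t - H) t, s ∈ Icc (T₀ + k * Θ - H) (T₀ + k * Θ + Θ) := fun s hs =>
    ⟨by linarith [hs.1], by linarith [hs.2]⟩
  intro i j s hs
  have ht' := hmem t ⟨by linarith [hN.delay_nonneg], le_rfl⟩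
  rw [abs_le]
  constructor
  · linarith [h1 j s (hmem s hs), h2 i t ht']
  · linarith [h2 j s (hmem s hs), h1 i t ht']

end Averaging

/-! ### Variation of constants by duality -/

theorem intervalIntegrable_of_continuousOn_Ici {E : Type*} [NormedAddCommGroup E] {x : ℝ → E}
    (hx : ContinuousOn x (Ici 0)) {t : ℝ} (ht : 0 ≤ t) : IntervalIntegrable x volume 0 t :=
  (hx.mono (by rw [uIcc_of_le ht]; exact Icc_subset_Ici_self)).intervalIntegrable

namespace MultiAgent.SolvesODE

section General

variable {E : Type*} [NormedAddCommGroup E] [NormedSpace ℝ E] {x y f g : ℝ → E}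

theorem continuousOn (hx : SolvesODE x f) : ContinuousOn x (Ici 0) := by
  intro t ht
  have ht0 : (0 : ℝ) ≤ t := ht
  have h1 : ContinuousOn (fun s => ∫ r in (0 : ℝ)..s, f r) (uIcc 0 (t + 1)) :=
    intervalIntegral.continuousOn_primitive_interval' (hx (t + 1) (by linarith)).1 left_mem_uIcc
  rw [uIcc_of_le (by linarith)] at h1
  have h2 : ContinuousOn x (Icc 0 (t + 1)) :=
    (continuousOn_const.add h1).congr fun s hs => (hx s hs.1).2
  refine (h2 t ⟨ht0, by linarith⟩).mono_of_mem_nhdsWithin ?_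
  have : Icc 0 (t + 1) = Ici 0 ∩ Iic (t + 1) := rfl
  rw [this]
  exact inter_mem self_mem_nhdsWithin (mem_nhdsWithin_of_mem_nhds (Iic_mem_nhds (by linarith)))

theorem congr (hx : SolvesODE x f) (hxy : ∀ t, 0 ≤ t → x t = y t) (hfg : ∀ t, 0 ≤ t → f t = g t) :
    SolvesODE y g := fun t ht => by
  have hfg' : EqOn f g (uIoc 0 t) := fun s hs => by
    rw [uIoc_of_le ht] at hs
    exact hfg s hs.1.le
  refine ⟨(hx t ht).1.congr hfg', ?_⟩
  rw [← hxy t ht, ← hxy 0 le_rfl, (hx t ht).2]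
  congr 1
  refine intervalIntegral.integral_congr fun s hs => ?_
  rw [uIcc_of_le ht] at hs
  exact hfg s hs.1

theorem sub (hx : SolvesODE x f) (hy : SolvesODE y g) :
    SolvesODE (fun t => x t - y t) (fun t => f t - g t) := fun t ht => by
  refine ⟨(hx t ht).1.sub (hy t ht).1, ?_⟩
  rw [intervalIntegral.integral_sub (hx t ht).1 (hy t ht).1]
  beta_reduce
  rw [(hx t ht).2, (hy t ht).2]
  abel

theorem clm_comp {E' : Type*} [NormedAddCommGroup E'] [NormedSpace ℝ E'] [CompleteSpace E]
    [CompleteSpace E'] (A : E →L[ℝ] E') (hx : SolvesODE x f) :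
    SolvesODE (fun t => A (x t)) (fun t => A (f t)) := fun t ht => by
  refine ⟨⟨A.integrable_comp (hx t ht).1.1, A.integrable_comp (hx t ht).1.2⟩, ?_⟩
  rw [A.intervalIntegral_comp_comm (hx t ht).1, ← map_add, ← (hx t ht).2]

end General

/-- Pairing of a Carathéodory solution with a test function run backwards in time; this is
integration by parts for the absolutely continuous function `x`. -/
theorem dual {x f a a' : ℝ → ℝ} (hx : SolvesODE x f) (ha : ∀ s, HasDerivAt a (a' s) s)
    (ha' : Continuous a') {t : ℝ} (ht : 0 ≤ t) :
    a 0 * x t = a t * x 0 + ∫ s in (0 : ℝ)..t, (a (t - s) * f s - a' (t - s) * x s) := by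
  have hac : Continuous a := continuous_iff_continuousAt.2 fun s => (ha s).continuousAt
  have hb : ∀ s, HasDerivAt (fun s => a (t - s)) (-a' (t - s)) s := fun s =>
    ((ha (t - s)).comp s ((hasDerivAt_id s).const_sub t)).congr_deriv (by simp)
  have hf := (hx t ht).1
  have hF := hf.absolutelyContinuousOnInterval_intervalIntegral (c := 0) left_mem_uIcc
  have hG : AbsolutelyContinuousOnInterval (fun s => a (t - s)) 0 t := by
    refine ContDiffOn.absolutelyContinuousOnInterval (ContDiff.contDiffOn ?_)
    rw [contDiff_one_iff_deriv]
    refine ⟨fun s => (hb s).differentiableAt, ?_⟩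
    rw [show deriv (fun s => a (t - s)) = fun s => -a' (t - s) from funext fun s => (hb s).deriv]
    fun_prop
  have hparts := hG.integral_deriv_mul_eq_sub hF
  have hcongr : ∫ s in (0 : ℝ)..t, (deriv (fun s => a (t - s)) s * (∫ r in (0 : ℝ)..s, f r) +
      a (t - s) * deriv (fun s => ∫ r in (0 : ℝ)..s, f r) s) =
      ∫ s in (0 : ℝ)..t, ((a (t - s) * f s - a' (t - s) * x s) + a' (t - s) * x 0) := by
    refine intervalIntegral.integral_congr_ae ?_
    filter_upwards [hf.ae_hasDerivAt_integral] with s hs hmem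
    have hs' := uIoc_subset_uIcc hmem
    rw [(hb s).deriv, (hs hs' 0 left_mem_uIcc).deriv]
    rw [uIcc_of_le ht] at hs'
    rw [(hx s hs'.1).2]
    ring
  have hint1 : IntervalIntegrable (fun s => a (t - s) * f s - a' (t - s) * x s) volume 0 t :=
    (hf.continuousOn_mul (by fun_prop)).sub
      ((intervalIntegrable_of_continuousOn_Ici hx.continuousOn ht).continuousOn_mul (by fun_prop))
  have hint2 : IntervalIntegrable (fun s => a' (t - s) * x 0) volume 0 t :=
    Continuous.intervalIntegrable (by fun_prop) _ _
  have hfund : ∫ s in (0 : ℝ)..t, -a' (t - s) = a (t - t) - a (t - 0) :=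
    intervalIntegral.integral_eq_sub_of_hasDerivAt (fun s _ => hb s)
      (Continuous.intervalIntegrable (by fun_prop) _ _)
  rw [hcongr, intervalIntegral.integral_add hint1 hint2, intervalIntegral.integral_mul_const]
    at hparts
  rw [intervalIntegral.integral_neg] at hfund
  simp only [sub_self, sub_zero, intervalIntegral.integral_same, mul_zero] at hparts hfund
  have h0 := (hx t ht).2
  rw [h0]
  have h1 : ∫ s in (0 : ℝ)..t, a' (t - s) = a t - a 0 := by linarith
  rw [h1] at hparts
  linarith

end MultiAgent.SolvesODE

open MultiAgent

/-- Convolution with an exponentially decaying kernel has finite asymptotic gain. -/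
theorem eventually_abs_convolution_le {a e : ℝ → ℝ} {C ε : ℝ} (ha : Continuous a)
    (haC : ∀ x, 0 ≤ x → |a x| ≤ C * Real.exp (-x))
    (he : ∀ t, 0 ≤ t → IntervalIntegrable e volume 0 t) (hε : 0 < ε)
    (hev : ∀ᶠ t in atTop, |e t| ≤ ε) :
    ∀ᶠ t in atTop, |∫ s in (0 : ℝ)..t, a (t - s) * e s| ≤ (C + 1) * ε := by
  have hC : 0 ≤ C := by
    have := (abs_nonneg _).trans (haC 0 le_rfl)
    simpa using this
  obtain ⟨T₁, hT₁⟩ := eventually_atTop.1 hev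
  set T₀ := max T₁ 0 with hT₀
  have hT₀0 : 0 ≤ T₀ := le_max_right _ _
  have heT : ∀ t, T₀ ≤ t → |e t| ≤ ε := fun t ht => hT₁ t ((le_max_left _ _).trans ht)
  set I := ∫ s in (0 : ℝ)..T₀, |e s| with hI
  have hlim : Tendsto (fun t => C * Real.exp T₀ * I * Real.exp (-t)) atTop (𝓝 0) := by
    simpa using (Real.tendsto_exp_neg_atTop_nhds_zero).const_mul (C * Real.exp T₀ * I)
  filter_upwards [hlim.eventually_le_const hε, eventually_ge_atTop T₀] with t ht1 ht
  have ht0 : 0 ≤ t := hT₀0.trans ht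
  have hi1 := he T₀ hT₀0
  have hi2 : IntervalIntegrable e volume T₀ t := (he t ht0).mono_set
    (by rw [uIcc_of_le ht, uIcc_of_le ht0]; exact Icc_subset_Icc_left hT₀0)
  rw [← intervalIntegral.integral_add_adjacent_intervals (hi1.continuousOn_mul (by fun_prop))
    (hi2.continuousOn_mul (by fun_prop))]
  refine (abs_add_le _ _).trans ?_
  have h1 : |∫ s in (0 : ℝ)..T₀, a (t - s) * e s| ≤ C * Real.exp T₀ * I * Real.exp (-t) := by
    have h2 : C * Real.exp T₀ * I * Real.exp (-t) =
        ∫ s in (0 : ℝ)..T₀, C * Real.exp (-(t - T₀)) * |e s| := by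
      rw [intervalIntegral.integral_const_mul, neg_sub, sub_eq_add_neg, Real.exp_add]
      ring
    rw [h2, ← Real.norm_eq_abs]
    refine intervalIntegral.norm_integral_le_of_norm_le hT₀0 ?_ (hi1.abs.const_mul _)
    refine Filter.Eventually.of_forall fun s hs => ?_
    rw [norm_mul, Real.norm_eq_abs, Real.norm_eq_abs]
    gcongr
    refine (haC _ (by linarith [hs.2])).trans ?_
    gcongr
    exact hs.2
  have h2 : |∫ s in T₀..t, a (t - s) * e s| ≤ C * ε := by
    have hd : ∀ s ∈ uIcc T₀ t, HasDerivAt (fun s => C * ε * Real.exp (-(t - s)))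
        (C * ε * Real.exp (-(t - s))) s := fun s _ =>
      (((((hasDerivAt_id s).const_sub t).neg).exp).const_mul (C * ε)).congr_deriv (by simp)
    have h3 := intervalIntegral.integral_eq_sub_of_hasDerivAt hd
      (Continuous.intervalIntegrable (by fun_prop) _ _)
    have h4 : |∫ s in T₀..t, a (t - s) * e s| ≤ ∫ s in T₀..t, C * ε * Real.exp (-(t - s)) := by
      rw [← Real.norm_eq_abs]
      refine intervalIntegral.norm_integral_le_of_norm_le ht ?_
        (Continuous.intervalIntegrable (by fun_prop) _ _)
      refine Filter.Eventually.of_forall fun s hs => ?_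
      rw [norm_mul, Real.norm_eq_abs, Real.norm_eq_abs]
      calc |a (t - s)| * |e s| ≤ (C * Real.exp (-(t - s))) * ε := by
            gcongr
            · exact haC _ (by linarith [hs.2])
            · exact heT s hs.1.le
        _ = _ := by ring
    rw [h3] at h4
    have h5 : 0 ≤ C * ε * Real.exp (-(t - T₀)) := by positivity
    simp only [sub_self, neg_zero, Real.exp_zero, mul_one] at h4
    linarith
  linarith

theorem eventually_abs_mul_exp_decay_le {a : ℝ → ℝ} {C ε : ℝ}
    (haC : ∀ x, 0 ≤ x → |a x| ≤ C * Real.exp (-x)) (b : ℝ) (hε : 0 < ε) :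
    ∀ᶠ t in atTop, |a t * b| ≤ ε := by
  have hlim : Tendsto (fun t => C * |b| * Real.exp (-t)) atTop (𝓝 0) := by
    simpa using (Real.tendsto_exp_neg_atTop_nhds_zero).const_mul (C * |b|)
  filter_upwards [hlim.eventually_le_const hε, eventually_ge_atTop 0] with t ht ht0
  rw [abs_mul]
  calc |a t| * |b| ≤ C * Real.exp (-t) * |b| := by gcongr; exact haC t ht0
    _ = C * |b| * Real.exp (-t) := by ring
    _ ≤ ε := ht

/-- The integrator driven by `e`, seen as a first-order filter with its own output as input. -/
theorem exists_leader_kernel : ∃ (g tail : ℝ → ℝ) (C : ℝ), IsPositiveKernel g tail ∧ 0 < C ∧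
    ∀ q e : ℝ → ℝ, SolvesODE q e → ∃ d : ℝ → ℝ,
      (∀ t, 0 ≤ t → q t = freeResponse g q t 0 + d t) ∧
      ∀ ε, 0 < ε → (∀ᶠ t in atTop, |e t| ≤ ε) → ∀ᶠ t in atTop, |d t| ≤ C * ε := by
  have hd : ∀ x : ℝ, HasDerivAt (fun x => Real.exp (-x)) (-Real.exp (-x)) x := fun x =>
    ((hasDerivAt_neg x).exp).congr_deriv (by ring)
  have hb : ∀ x : ℝ, 0 ≤ x → |Real.exp (-x)| ≤ 1 * Real.exp (-x) := fun x _ => by simp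
  refine ⟨_, _, 3, isPositiveKernel_exp_neg, by norm_num, fun q e hq => ⟨fun t =>
    Real.exp (-t) * q 0 + ∫ s in (0 : ℝ)..t, Real.exp (-(t - s)) * e s, fun t ht => ?_,
    fun ε hε hev => ?_⟩⟩
  · have h1 := hq.dual hd (by fun_prop) ht
    have hi1 : IntervalIntegrable (fun s => Real.exp (-(t - s)) * e s) volume 0 t :=
      (hq t ht).1.continuousOn_mul (by fun_prop)
    have hi2 : IntervalIntegrable (fun s => Real.exp (-(t - s)) * q s) volume 0 t :=
      (intervalIntegrable_of_continuousOn_Ici hq.continuousOn ht).continuousOn_mul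
        (by fun_prop)
    simp only [neg_mul, sub_neg_eq_add] at h1
    rw [intervalIntegral.integral_add hi1 hi2] at h1
    simp only [neg_zero, Real.exp_zero, one_mul] at h1
    simp only [freeResponse, add_zero]
    linarith
  · filter_upwards [eventually_abs_convolution_le (by fun_prop) hb (fun t ht => (hq t ht).1) hε hev,
      eventually_abs_mul_exp_decay_le hb (q 0) hε] with t h1 h2
    exact (abs_add_le _ _).trans (by linarith)

/-- The synchronization filter of a follower is, up to a disturbance, convolution of its input with
a positive kernel. -/
theorem exists_follower_kernel {k lam : ℝ} (hk : 2 < k) (hlam : k - 1 < lam) :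
    ∃ (g tail : ℝ → ℝ) (C : ℝ), IsPositiveKernel g tail ∧ 0 < C ∧
    ∀ q η φ e u : ℝ → ℝ, SolvesODE q (fun t => η t + e t) →
      SolvesODE η (fun t => -(k * η t) - lam * (q t - φ t)) → SolvesODE φ (fun t => -φ t + u t) →
      ∃ d : ℝ → ℝ, (∀ t, 0 ≤ t → q t = freeResponse g u t 0 + d t) ∧
        ∀ ε, 0 < ε → (∀ᶠ t in atTop, |e t| ≤ ε) → ∀ᶠ t in atTop, |d t| ≤ C * ε := by
  obtain ⟨α, β, γ, hα0, hβ0, hγ0, hα, hβ, hγ, ⟨C, hC⟩, hker⟩ := exists_filter_kernel hk hlam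
  obtain ⟨C', hC'⟩ := hker.upper
  have hC0 : 0 ≤ C := by
    have := (abs_nonneg _).trans (hC 0 le_rfl).1
    simpa using this
  have hαc : Continuous α := continuous_iff_continuousAt.2 fun x => (hα x).continuousAt
  have hβc : Continuous β := continuous_iff_continuousAt.2 fun x => (hβ x).continuousAt
  have hγc : Continuous γ := hker.cont
  refine ⟨γ, _, C + 4, hker, by positivity, fun q η φ e u hq hη hφ => ⟨fun t =>
    α t * q 0 + β t * η 0 + γ t * φ 0 + ∫ s in (0 : ℝ)..t, α (t - s) * e s, fun t ht => ?_,
    fun ε hε hev => ?_⟩⟩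
  · have h1 := hq.dual hα (by fun_prop) ht
    have h2 := hη.dual hβ (by fun_prop) ht
    have h3 := hφ.dual hγ (by fun_prop) ht
    have hqi := intervalIntegrable_of_continuousOn_Ici hq.continuousOn ht
    have hηi := intervalIntegrable_of_continuousOn_Ici hη.continuousOn ht
    have hφi := intervalIntegrable_of_continuousOn_Ici hφ.continuousOn ht
    have hei : IntervalIntegrable e volume 0 t := by simpa using (hq t ht).1.sub hηi
    have hui : IntervalIntegrable u volume 0 t := by simpa using (hφ t ht).1.add hφi
    have i1 : IntervalIntegrable (fun s => α (t - s) * (η s + e s) - -(lam * β (t - s)) * q s)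
        volume 0 t := ((hηi.add hei).continuousOn_mul (by fun_prop)).sub
      (hqi.continuousOn_mul (by fun_prop))
    have i2 : IntervalIntegrable (fun s => β (t - s) * (-(k * η s) - lam * (q s - φ s)) -
        (α (t - s) - k * β (t - s)) * η s) volume 0 t :=
      ((hη t ht).1.continuousOn_mul (by fun_prop)).sub (hηi.continuousOn_mul (by fun_prop))
    have i3 : IntervalIntegrable (fun s => γ (t - s) * (-φ s + u s) -
        (lam * β (t - s) - γ (t - s)) * φ s) volume 0 t :=
      ((hφ t ht).1.continuousOn_mul (by fun_prop)).sub (hφi.continuousOn_mul (by fun_prop))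
    have i4 : IntervalIntegrable (fun s => γ (t - s) * u s) volume 0 t :=
      hui.continuousOn_mul (by fun_prop)
    have i5 : IntervalIntegrable (fun s => α (t - s) * e s) volume 0 t :=
      hei.continuousOn_mul (by fun_prop)
    -- in the sum of the three pairings only the inputs `u` and `e` survive
    have hsum := intervalIntegral.integral_add (i1.add i2) i3
    rw [intervalIntegral.integral_add i1 i2] at hsum
    have hsum' := intervalIntegral.integral_add i4 i5
    have hcongr : ∫ s in (0 : ℝ)..t, ((α (t - s) * (η s + e s) - -(lam * β (t - s)) * q s) +
        (β (t - s) * (-(k * η s) - lam * (q s - φ s)) - (α (t - s) - k * β (t - s)) * η s) +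
        (γ (t - s) * (-φ s + u s) - (lam * β (t - s) - γ (t - s)) * φ s)) =
        ∫ s in (0 : ℝ)..t, (γ (t - s) * u s + α (t - s) * e s) :=
      intervalIntegral.integral_congr fun s _ => by ring
    rw [hα0] at h1
    rw [hβ0] at h2
    rw [hγ0] at h3
    simp only [freeResponse, add_zero]
    linarith
  · filter_upwards [eventually_abs_convolution_le hαc (fun x hx => (hC x hx).1)
      (fun t ht => by
        simpa using (hq t ht).1.sub
          (intervalIntegrable_of_continuousOn_Ici hη.continuousOn ht)) hε hev,
      eventually_abs_mul_exp_decay_le (fun x hx => (hC x hx).1) (q 0) hε,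
      eventually_abs_mul_exp_decay_le (fun x hx => (hC x hx).2) (η 0) hε,
      eventually_abs_mul_exp_decay_le (fun x hx => by
        rw [abs_of_nonneg (hker.nonneg x hx)]; exact (hC' x hx).1) (φ 0) hε] with t h1 h2 h3 h4
    refine (abs_add_le _ _).trans ?_
    linarith [abs_add_le (α t * q 0 + β t * η 0) (γ t * φ 0), abs_add_le (α t * q 0) (β t * η 0)]

/-- The dual of the system `η̇ = -k η - lam z`, `ż = η - z` decays like `exp (-x)`. -/
theorem exists_decaying_dual {k lam : ℝ} (hk : 1 ≤ k) (hlam : 0 < lam) (a₀ b₀ : ℝ) :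
    ∃ a b : ℝ → ℝ, a 0 = a₀ ∧ b 0 = b₀ ∧ (∀ x, HasDerivAt a (-k * a x + 1 * b x) x) ∧
      (∀ x, HasDerivAt b (-lam * a x + -1 * b x) x) ∧
      ∃ C, 0 ≤ C ∧ ∀ x, 0 ≤ x → |a x| ≤ C * Real.exp (-x) ∧ |b x| ≤ C * Real.exp (-x) := by
  obtain ⟨a, b, ha0, hb0, ha, hb⟩ := exists_planar_linear_solution (-k) 1 (-lam) (-1) a₀ b₀
  refine ⟨a, b, ha0, hb0, ha, hb, ?_⟩
  set E : ℝ → ℝ := fun x => Real.exp (2 * x) * (lam * a x ^ 2 + b x ^ 2) with hE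
  have hE' : ∀ x, HasDerivAt E (-(Real.exp (2 * x) * (2 * lam * (k - 1) * a x ^ 2))) x := fun x => by
    have h1 : HasDerivAt (fun x : ℝ => Real.exp (2 * x)) (Real.exp (2 * x) * 2) x :=
      (((hasDerivAt_id x).const_mul 2).exp).congr_deriv (by simp)
    refine (h1.mul ((((ha x).pow 2).const_mul lam).add ((hb x).pow 2))).congr_deriv ?_
    simp only [Pi.add_apply, Pi.pow_apply]
    push_cast
    ring
  have hanti : Antitone E := antitone_of_hasDerivAt_nonpos hE' fun x => by
    have : 0 ≤ Real.exp (2 * x) * (2 * lam * (k - 1) * a x ^ 2) := by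
      have : 0 ≤ k - 1 := by linarith
      positivity
    simpa using this
  have hE0 : 0 ≤ E 0 := by simp only [hE]; positivity
  have hbound : ∀ x, 0 ≤ x → lam * a x ^ 2 + b x ^ 2 ≤ E 0 * Real.exp (-x) ^ 2 := fun x hx => by
    have h1 : Real.exp (2 * x) * (lam * a x ^ 2 + b x ^ 2) ≤ E 0 := hanti hx
    have h2 : Real.exp (-x) ^ 2 * Real.exp (2 * x) = 1 := by
      rw [← Real.exp_nat_mul, ← Real.exp_add]; simp
    calc lam * a x ^ 2 + b x ^ 2
        = (Real.exp (-x) ^ 2 * Real.exp (2 * x)) * (lam * a x ^ 2 + b x ^ 2) := by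
          rw [h2, one_mul]
      _ = Real.exp (-x) ^ 2 * (Real.exp (2 * x) * (lam * a x ^ 2 + b x ^ 2)) := by ring
      _ ≤ Real.exp (-x) ^ 2 * E 0 := by gcongr
      _ = _ := by ring
  refine ⟨√(E 0 / lam) + √(E 0), by positivity, fun x hx => ⟨?_, ?_⟩⟩
  · refine le_trans (b := √(E 0 / lam) * Real.exp (-x)) (abs_le_of_sq_le_sq ?_ (by positivity)) ?_
    · rw [mul_pow, Real.sq_sqrt (by positivity), div_mul_eq_mul_div, le_div_iff₀ hlam]
      nlinarith [hbound x hx, sq_nonneg (b x)]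
    · gcongr
      linarith [Real.sqrt_nonneg (E 0)]
  · refine le_trans (b := √(E 0) * Real.exp (-x)) (abs_le_of_sq_le_sq ?_ (by positivity)) ?_
    · rw [mul_pow, Real.sq_sqrt hE0]
      nlinarith [hbound x hx, mul_nonneg hlam.le (sq_nonneg (a x))]
    · gcongr
      linarith [Real.sqrt_nonneg (E 0 / lam)]

/-- Once its input `v` is small, the internal state of the synchronization filter is small. -/
theorem exists_internal_gain {k lam : ℝ} (hk : 1 ≤ k) (hlam : 0 < lam) :
    ∃ C, 0 < C ∧ ∀ η z v : ℝ → ℝ, SolvesODE η (fun t => -(k * η t) - lam * z t) →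
      SolvesODE z (fun t => η t - z t + v t) → ∀ ε, 0 < ε → (∀ᶠ t in atTop, |v t| ≤ ε) →
      ∀ᶠ t in atTop, |η t| ≤ C * ε ∧ |z t| ≤ C * ε := by
  have key : ∀ a₀ b₀ : ℝ, ∃ C, 0 < C ∧ ∀ η z v : ℝ → ℝ,
      SolvesODE η (fun t => -(k * η t) - lam * z t) →
      SolvesODE z (fun t => η t - z t + v t) → ∀ ε, 0 < ε → (∀ᶠ t in atTop, |v t| ≤ ε) →
      ∀ᶠ t in atTop, |a₀ * η t + b₀ * z t| ≤ C * ε := fun a₀ b₀ => by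
    obtain ⟨a, b, ha0, hb0, ha, hb, C, hC0, hC⟩ := exists_decaying_dual hk hlam a₀ b₀
    have hac : Continuous a := continuous_iff_continuousAt.2 fun x => (ha x).continuousAt
    have hbc : Continuous b := continuous_iff_continuousAt.2 fun x => (hb x).continuousAt
    refine ⟨C + 3, by positivity, fun η z v hη hz ε hε hev => ?_⟩
    have hv : ∀ t, 0 ≤ t → IntervalIntegrable v volume 0 t := fun t ht => by
      simpa using (hz t ht).1.sub
        ((intervalIntegrable_of_continuousOn_Ici hη.continuousOn ht).sub
          (intervalIntegrable_of_continuousOn_Ici hz.continuousOn ht))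
    filter_upwards [eventually_abs_convolution_le hbc (fun x hx => (hC x hx).2) hv hε hev,
      eventually_abs_mul_exp_decay_le (fun x hx => (hC x hx).1) (η 0) hε,
      eventually_abs_mul_exp_decay_le (fun x hx => (hC x hx).2) (z 0) hε,
      eventually_ge_atTop 0] with t h1 h2 h3 ht
    have hηi := intervalIntegrable_of_continuousOn_Ici hη.continuousOn ht
    have hzi := intervalIntegrable_of_continuousOn_Ici hz.continuousOn ht
    have d1 := hη.dual ha (by fun_prop) ht
    have d2 := hz.dual hb (by fun_prop) ht
    have hsum := intervalIntegral.integral_add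
      (((hη t ht).1.continuousOn_mul (g := fun s => a (t - s)) (by fun_prop)).sub
        (hηi.continuousOn_mul (g := fun s => -k * a (t - s) + 1 * b (t - s)) (by fun_prop)))
      (((hz t ht).1.continuousOn_mul (g := fun s => b (t - s)) (by fun_prop)).sub
        (hzi.continuousOn_mul (g := fun s => -lam * a (t - s) + -1 * b (t - s)) (by fun_prop)))
    have hcongr : ∫ s in (0 : ℝ)..t, ((a (t - s) * (-(k * η s) - lam * z s) -
          (-k * a (t - s) + 1 * b (t - s)) * η s) + (b (t - s) * (η s - z s + v s) -
          (-lam * a (t - s) + -1 * b (t - s)) * z s)) = ∫ s in (0 : ℝ)..t, b (t - s) * v s :=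
      intervalIntegral.integral_congr fun s _ => by ring
    rw [ha0] at d1
    rw [hb0] at d2
    have hval : a₀ * η t + b₀ * z t =
        a t * η 0 + b t * z 0 + ∫ s in (0 : ℝ)..t, b (t - s) * v s := by linarith
    rw [hval]
    refine (abs_add_le _ _).trans ?_
    linarith [abs_add_le (a t * η 0) (b t * z 0)]
  obtain ⟨C₁, hC₁, h₁⟩ := key 1 0
  obtain ⟨C₂, hC₂, h₂⟩ := key 0 1
  refine ⟨C₁ + C₂, by positivity, fun η z v hη hz ε hε hev => ?_⟩
  filter_upwards [h₁ η z v hη hz ε hε hev, h₂ η z v hη hz ε hε hev] with t h3 h4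
  have h5 : 0 ≤ C₁ * ε := by positivity
  have h6 : 0 ≤ C₂ * ε := by positivity
  simp only [one_mul, zero_mul, add_zero, zero_add] at h3 h4
  exact ⟨by linarith, by linarith⟩

/-! ### Asymptotic gain of the synchronization scheme in one coordinate -/

/-- In one coordinate: the disagreement and the internal states of the synchronization filters are
eventually bounded by a fixed multiple of the tracking errors `e`. Agents with `f i` run a
synchronization filter; the others integrate their tracking error. -/
theorem exists_synchronization_gain {ι : Type*} [Fintype ι] {w : ι → ι → ℝ} {σ : ι → ι → ℝ → ℝ}
    {H : ℝ} (hH : 0 ≤ H) (hw0 : ∀ i j, 0 ≤ w i j) (hw1 : ∀ i, ∑ j, w i j = 1)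
    (hσ : ∀ i j s, H ≤ s → σ i j s ∈ Icc (s - H) s) {r : ι}
    (hpath : ∀ i, Relation.ReflTransGen (fun j i => 0 < w i j) r i) (f : ι → Prop) (k lam : ι → ℝ)
    (hk : ∀ i, f i → 2 < k i) (hlam : ∀ i, f i → k i - 1 < lam i) :
    ∃ C, 0 < C ∧ ∀ q η φ e u : ι → ℝ → ℝ,
      (∀ i, f i → SolvesODE (q i) (fun t => η i t + e i t) ∧
        SolvesODE (η i) (fun t => -(k i * η i t) - lam i * (q i t - φ i t)) ∧
        SolvesODE (φ i) (fun t => -φ i t + u i t)) →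
      (∀ i, ¬ f i → SolvesODE (q i) (e i) ∧ u i = q i) →
      (∀ i s, H ≤ s → u i s = ∑ j, w i j * q j (σ i j s)) →
      ∀ ε, 0 < ε → (∀ᶠ t in atTop, ∀ i, |e i t| ≤ ε) →
        ∀ᶠ t in atTop, (∀ i j, |q i t - q j t| ≤ C * ε) ∧
          ∀ i, f i → |η i t| ≤ C * ε ∧ |q i t - φ i t| ≤ C * ε := by
  have hkernel : ∀ i, ∃ (g tail : ℝ → ℝ) (C : ℝ), IsPositiveKernel g tail ∧ 0 < C ∧
      (∀ q η φ e u : ℝ → ℝ,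
        (f i → SolvesODE q (fun t => η t + e t) ∧
          SolvesODE η (fun t => -(k i * η t) - lam i * (q t - φ t)) ∧
          SolvesODE φ (fun t => -φ t + u t)) → (¬ f i → SolvesODE q e ∧ u = q) →
        ∃ d : ℝ → ℝ, (∀ t, 0 ≤ t → q t = freeResponse g u t 0 + d t) ∧
          ∀ ε, 0 < ε → (∀ᶠ t in atTop, |e t| ≤ ε) → ∀ᶠ t in atTop, |d t| ≤ C * ε) := fun i => by
    by_cases hi : f i
    · obtain ⟨g, tail, C, hg, hC, h⟩ := exists_follower_kernel (hk i hi) (hlam i hi)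
      exact ⟨g, tail, C, hg, hC, fun q η φ e u h1 _ =>
        h q η φ e u (h1 hi).1 (h1 hi).2.1 (h1 hi).2.2⟩
    · obtain ⟨g, tail, C, hg, hC, h⟩ := exists_leader_kernel
      exact ⟨g, tail, C, hg, hC, fun q η φ e u _ h2 => by
        obtain ⟨hq, rfl⟩ := h2 hi
        exact h _ e hq⟩
  choose g tail C₁ hg hC₁ hresp using hkernel
  have hN : IsAveragingScheme w σ g tail H := ⟨hH, hw0, hw1, hσ, hg⟩
  obtain ⟨C₂, hC₂, hdis⟩ := hN.exists_disagreement_gain hpath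
  have hinternal : ∀ i, ∃ C, 0 < C ∧ (f i → ∀ η z v : ℝ → ℝ,
      SolvesODE η (fun t => -(k i * η t) - lam i * z t) →
      SolvesODE z (fun t => η t - z t + v t) → ∀ ε, 0 < ε → (∀ᶠ t in atTop, |v t| ≤ ε) →
      ∀ᶠ t in atTop, |η t| ≤ C * ε ∧ |z t| ≤ C * ε) := fun i => by
    by_cases hi : f i
    · obtain ⟨C, hC, h⟩ := exists_internal_gain (k := k i) (lam := lam i)
        (by linarith [hk i hi]) (by linarith [hk i hi, hlam i hi])
      exact ⟨C, hC, fun _ => h⟩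
    · exact ⟨1, one_pos, fun h => absurd h hi⟩
  choose C₃ hC₃ hint using hinternal
  have : Nonempty ι := ⟨r⟩
  have hS₁ : ∀ i, C₁ i ≤ ∑ j, C₁ j := fun i =>
    Finset.single_le_sum (fun j _ => (hC₁ j).le) (Finset.mem_univ i)
  have hS₃ : ∀ i, C₃ i ≤ ∑ j, C₃ j := fun i =>
    Finset.single_le_sum (fun j _ => (hC₃ j).le) (Finset.mem_univ i)
  have hp₁ : 0 < ∑ j, C₁ j := (hC₁ r).trans_le (hS₁ r)
  have hp₃ : 0 < ∑ j, C₃ j := (hC₃ r).trans_le (hS₃ r)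
  set S₁ := ∑ j, C₁ j with hS₁def
  set S₃ := ∑ j, C₃ j with hS₃def
  refine ⟨C₂ * S₁ + S₃ * (1 + C₂ * S₁), by positivity,
    fun q η φ e u hfol hlead havg ε hε hev => ?_⟩
  choose d hd hdgain using fun i => hresp i (q i) (η i) (φ i) (e i) (u i) (hfol i) (hlead i)
  have hqc : ∀ i, ContinuousOn (q i) (Ici 0) := fun i => by
    by_cases hi : f i
    · exact (hfol i hi).1.continuousOn
    · exact (hlead i hi).1.continuousOn
  have hui : ∀ i t, 0 ≤ t → IntervalIntegrable (u i) volume 0 t := fun i t ht => by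
    by_cases hi : f i
    · have hφ := (hfol i hi).2.2
      simpa using (hφ t ht).1.add (intervalIntegrable_of_continuousOn_Ici hφ.continuousOn ht)
    · rw [(hlead i hi).2]
      exact intervalIntegrable_of_continuousOn_Ici (hqc i) ht
  have hsol : IsAveragingSolution w σ g H q u d := ⟨hqc, hui, havg, hd⟩
  have hdev : ∀ᶠ t in atTop, ∀ i, |d i t| ≤ S₁ * ε := by
    refine eventually_all.2 fun i => ?_
    filter_upwards [hdgain i ε hε (hev.mono fun t ht => ht i)] with t ht
    exact ht.trans (mul_le_mul_of_nonneg_right (hS₁ i) hε.le)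
  have hgap := hdis q u d hsol (S₁ * ε) (by positivity) hdev
  have hqu : ∀ᶠ t in atTop, ∀ i, |q i t - u i t| ≤ C₂ * S₁ * ε := by
    filter_upwards [hgap, eventually_ge_atTop H] with t ht htH i
    have h1 : q i t - u i t = ∑ j, w i j * (q i t - q j (σ i j t)) := by
      simp only [mul_sub, Finset.sum_sub_distrib, ← Finset.sum_mul, hw1, one_mul]
      rw [havg i t htH]
    rw [h1]
    calc |∑ j, w i j * (q i t - q j (σ i j t))|
        ≤ ∑ j, |w i j * (q i t - q j (σ i j t))| := Finset.abs_sum_le_sum_abs _ _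
      _ ≤ ∑ j, w i j * (C₂ * S₁ * ε) := by
          refine Finset.sum_le_sum fun j _ => ?_
          rw [abs_mul, abs_of_nonneg (hw0 i j)]
          refine mul_le_mul_of_nonneg_left ?_ (hw0 i j)
          rw [mul_assoc]
          exact ht i j _ (hσ i j t htH)
      _ = C₂ * S₁ * ε := by rw [← Finset.sum_mul, hw1, one_mul]
  have hfil : ∀ᶠ t in atTop, ∀ i, f i →
      |η i t| ≤ S₃ * (1 + C₂ * S₁) * ε ∧ |q i t - φ i t| ≤ S₃ * (1 + C₂ * S₁) * ε := by
    refine eventually_all.2 fun i => ?_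
    by_cases hi : f i
    · obtain ⟨hq, hη, hφ⟩ := hfol i hi
      -- the input of the internal dynamics is bounded by the disagreement and the error
      have hz : SolvesODE (fun t => q i t - φ i t)
          (fun t => η i t - (q i t - φ i t) + (e i t + (q i t - u i t))) :=
        (hq.sub hφ).congr (fun _ _ => rfl) fun _ _ => by ring
      have hvev : ∀ᶠ t in atTop, |e i t + (q i t - u i t)| ≤ (1 + C₂ * S₁) * ε := by
        filter_upwards [hev, hqu] with t h1 h2
        exact (abs_add_le _ _).trans (by linarith [h1 i, h2 i])
      filter_upwards [hint i hi (η i) _ _ hη hz _ (by positivity) hvev] with t ht _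
      have hle : C₃ i * ((1 + C₂ * S₁) * ε) ≤ S₃ * (1 + C₂ * S₁) * ε := by
        rw [mul_assoc]
        exact mul_le_mul_of_nonneg_right (hS₃ i) (by positivity)
      exact ⟨ht.1.trans hle, ht.2.trans hle⟩
    · exact Eventually.of_forall fun _ h => absurd h hi
  filter_upwards [hgap, hfil] with t h1 h2
  have h3 : 0 ≤ S₃ * (1 + C₂ * S₁) * ε := by positivity
  have h4 : 0 ≤ C₂ * S₁ * ε := by positivity
  refine ⟨fun i j => ?_, fun i hi => ⟨?_, ?_⟩⟩
  · linarith [h1 i j t ⟨by linarith, le_rfl⟩]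
  · linarith [(h2 i hi).1]
  · linarith [(h2 i hi).2]

/-! ### Gains, communication and graph -/

/-- A margin greater than `1` is the Routh–Hurwitz condition for the polynomial shifted by `1`. -/
theorem gains_of_one_lt_rootMargin {k lam : ℝ} (h : 1 < rootMargin k lam) :
    2 < k ∧ k - 1 < lam := by
  have hre : ∀ r : ℂ, r ^ 2 + (k : ℂ) * r + (lam : ℂ) = 0 → r.re < -1 := fun r hr => by
    have hsub : {x : ℂ | x ^ 2 + (k : ℂ) * x + (lam : ℂ) = 0} ⊆ {r, -k - r} := fun x hx => by
      have h1 : (x - r) * (x - (-k - r)) = 0 := by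
        have hx' : x ^ 2 + (k : ℂ) * x + (lam : ℂ) = 0 := hx
        linear_combination hx' - hr
      rcases mul_eq_zero.1 h1 with h1 | h1
      · exact Or.inl (sub_eq_zero.1 h1)
      · exact Or.inr (sub_eq_zero.1 h1)
    have hbdd : BddAbove (Complex.re '' {x : ℂ | x ^ 2 + (k : ℂ) * x + (lam : ℂ) = 0}) :=
      (((Set.toFinite _).subset hsub).image _).bddAbove
    have := le_csSup hbdd (mem_image_of_mem Complex.re hr)
    unfold rootMargin at h
    linarith
  rcases le_total 0 (k ^ 2 - 4 * lam) with hD | hD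
  · set s := √(k ^ 2 - 4 * lam) with hs
    have hs2 : s ^ 2 = k ^ 2 - 4 * lam := Real.sq_sqrt hD
    have hs0 : 0 ≤ s := Real.sqrt_nonneg _
    have h1 := hre (((-k + s) / 2 : ℝ) : ℂ) (by
      norm_cast
      linear_combination (1 / 4 : ℝ) * hs2)
    rw [Complex.ofReal_re] at h1
    constructor <;> nlinarith
  · set s := √(4 * lam - k ^ 2) with hs
    have hs2 : s ^ 2 = 4 * lam - k ^ 2 := Real.sq_sqrt (by linarith)
    have hs2' : (s : ℂ) ^ 2 = 4 * lam - k ^ 2 := by exact_mod_cast hs2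
    have h1 := hre ((-k / 2 : ℝ) + (s / 2 : ℝ) * Complex.I) (by
      push_cast
      linear_combination (-1 / 4 : ℂ) * hs2' + ((s : ℂ) ^ 2 / 4) * Complex.I_sq)
    simp only [Complex.add_re, Complex.ofReal_re, Complex.mul_re, Complex.I_re, Complex.I_im,
      Complex.ofReal_im, mul_zero, sub_zero, zero_mul, add_zero] at h1
    refine ⟨by linarith, ?_⟩
    nlinarith [sq_nonneg (k - 2)]

/-- From time `kstar T + h` on, the most recent message has age at most `kstar T + h`. -/
theorem lastIndex_mul_mem_Icc {T h t : ℝ} (hT : 0 < T) (hh : 0 ≤ h) {kstar : ℕ} {τ : ℕ → ℝ≥0∞}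
    {K : ℕ → ℕ} (hK : StrictMono K) (hK0 : K 0 ≤ kstar) (hgap : ∀ l, K (l + 1) - K l ≤ kstar)
    (hτ : ∀ l, τ (K l) ≤ ENNReal.ofReal h) (ht : kstar * T + h ≤ t) :
    (delivered T τ t).Nonempty ∧ lastIndex T τ t * T ∈ Icc (t - (kstar * T + h)) t := by
  have ht0 : 0 ≤ t := le_trans (by positivity) ht
  have hbound : ∀ k ∈ delivered T τ t, (k : ℝ) * T ≤ t := fun k hk => by
    have h1 : ENNReal.ofReal (k * T) ≤ ENNReal.ofReal t := le_self_add.trans hk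
    exact (ENNReal.ofReal_le_ofReal_iff ht0).1 h1
  have hbdd : BddAbove (delivered T τ t) :=
    ⟨⌊t / T⌋₊, fun k hk => Nat.le_floor (by rw [le_div_iff₀ hT]; exact hbound k hk)⟩
  have hmem : ∀ l, (K l : ℝ) * T + h ≤ t → K l ∈ delivered T τ t := fun l hl => by
    have h1 : ENNReal.ofReal (K l * T) + τ (K l) ≤
        ENNReal.ofReal (K l * T) + ENNReal.ofReal h := by gcongr; exact hτ l
    rw [← ENNReal.ofReal_add (by positivity) hh] at h1
    exact h1.trans (ENNReal.ofReal_le_ofReal hl)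
  have h0 : (K 0 : ℝ) * T + h ≤ t := by
    have : (K 0 : ℝ) * T ≤ kstar * T := by gcongr
    linarith
  have hne : (delivered T τ t).Nonempty := ⟨_, hmem 0 h0⟩
  -- the first index of the sequence whose message may still be on its way at time `t`
  have hex : ∃ l, t < (K l : ℝ) * T + h := by
    obtain ⟨l, hl⟩ := exists_nat_gt (t / T)
    refine ⟨l, ?_⟩
    rw [div_lt_iff₀ hT] at hl
    have : (l : ℝ) * T ≤ K l * T := by
      gcongr
      exact hK.id_le l
    linarith
  classical
  have hl := Nat.find_spec hex
  have hmin := fun l => Nat.find_min hex (m := l)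
  set l := Nat.find hex with hldef
  have hlpos : l ≠ 0 := fun h => by
    rw [h] at hl
    linarith
  obtain ⟨l', hl'⟩ := Nat.exists_eq_succ_of_ne_zero hlpos
  have h1 : (K l' : ℝ) * T + h ≤ t := not_lt.1 (hmin l' (by omega))
  have h2 : (K l : ℝ) ≤ K l' + kstar := by
    have := hgap l'
    rw [hl']
    have h3 : K (l' + 1) ≤ K l' + kstar := by omega
    exact_mod_cast h3
  have h3 : K l' ≤ lastIndex T τ t := le_csSup hbdd (hmem l' h1)
  refine ⟨hne, ?_, hbound _ (Nat.sSup_mem hne hbdd)⟩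
  have h4 : (K l' : ℝ) * T ≤ lastIndex T τ t * T := by gcongr
  have h5 : (K l : ℝ) * T ≤ (K l' + kstar) * T := by gcongr
  linarith

theorem MultiAgent.IsWeightedAdjacency.nonneg {n : ℕ} {G : Digraph (Fin n)} {a : Fin n → Fin n → ℝ}
    (ha : IsWeightedAdjacency G a) (i j : Fin n) : 0 ≤ a i j := by
  by_cases h : G.Adj j i
  · exact (ha.pos i j h).le
  · exact (ha.zero i j h).ge

theorem MultiAgent.IsWeightedAdjacency.kappa_nonneg {n : ℕ} {G : Digraph (Fin n)}
    {a : Fin n → Fin n → ℝ} (ha : IsWeightedAdjacency G a) (i : Fin n) : 0 ≤ kappa a i :=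
  Finset.sum_nonneg fun j _ => ha.nonneg i j

theorem MultiAgent.IsWeightedAdjacency.kappa_ne_zero {n : ℕ} {G : Digraph (Fin n)}
    {a : Fin n → Fin n → ℝ} (ha : IsWeightedAdjacency G a) {i j : Fin n} (h : G.Adj j i) :
    kappa a i ≠ 0 :=
  ((ha.pos i j h).trans_le
    (Finset.single_le_sum (fun l _ => ha.nonneg i l) (Finset.mem_univ j))).ne'

open Classical in
/-- The averaging weights of the network: the normalized adjacency matrix, where an agent without
incoming links is given a self-loop. -/
noncomputable def averagingWeight {n : ℕ} (a : Fin n → Fin n → ℝ) (i j : Fin n) : ℝ :=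
  if kappa a i ≠ 0 then a i j / kappa a i else if i = j then 1 else 0

open Classical in
/-- The time from which the information of `i` about `j` dates; it is the current time if there is
no link from `j` to `i`. -/
noncomputable def informationTime {n : ℕ} (G : Digraph (Fin n)) (T : ℝ)
    (τ : Fin n → Fin n → ℕ → ℝ≥0∞) (i j : Fin n) (t : ℝ) : ℝ :=
  if G.Adj j i then lastIndex T (τ j i) t * T else t

theorem averagingWeight_nonneg {n : ℕ} {G : Digraph (Fin n)} {a : Fin n → Fin n → ℝ}
    (ha : IsWeightedAdjacency G a) (i j : Fin n) : 0 ≤ averagingWeight a i j := by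
  unfold averagingWeight
  split_ifs
  · exact div_nonneg (ha.nonneg i j) (ha.kappa_nonneg i)
  · exact zero_le_one
  · exact le_rfl

theorem sum_averagingWeight {n : ℕ} (a : Fin n → Fin n → ℝ) (i : Fin n) :
    ∑ j, averagingWeight a i j = 1 := by
  by_cases h : kappa a i = 0
  · simp [averagingWeight, h]
  · simp only [averagingWeight, ne_eq, h, not_false_eq_true, if_true]
    rw [← Finset.sum_div]
    exact div_self h

theorem informationTime_mem_Icc {n : ℕ} {G : Digraph (Fin n)} {T h : ℝ} (hT : 0 < T) (hh : 0 ≤ h)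
    {τ : Fin n → Fin n → ℕ → ℝ≥0∞} {kstar : ℕ} (hcomm : CommunicationAssumption G τ kstar h)
    (i j : Fin n) (t : ℝ) (ht : kstar * T + h ≤ t) :
    informationTime G T τ i j t ∈ Icc (t - (kstar * T + h)) t := by
  unfold informationTime
  split_ifs with hadj
  · obtain ⟨K, hK, hK0, hgap, hτ⟩ := hcomm j i hadj
    exact (lastIndex_mul_mem_Icc hT hh hK hK0 hgap hτ ht).2
  · exact ⟨by linarith [show (0 : ℝ) ≤ kstar * T + h by positivity], le_rfl⟩

/-- In coordinates moving with the desired velocity, the mean of the position estimates is the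
weighted average of the delayed positions. -/
theorem average_posEstimate {n m : ℕ} {G : Digraph (Fin n)} {a : Fin n → Fin n → ℝ}
    (ha : IsWeightedAdjacency G a) {T h : ℝ} (hT : 0 < T) (hh : 0 ≤ h)
    {τ : Fin n → Fin n → ℕ → ℝ≥0∞} {kstar : ℕ} (hcomm : CommunicationAssumption G τ kstar h)
    (vd : Vec m) (init : Fin n → Fin n → ℝ → Vec m) (p : Fin n → ℝ → Vec m) {i : Fin n}
    (hi : kappa a i ≠ 0) (c : Fin m) {t : ℝ} (ht : kstar * T + h ≤ t) :
    ((1 / kappa a i) • ∑ j, a i j • posEstimate T (τ j i) vd (init i j) (p j) t) c - t * vd c =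
      ∑ j, averagingWeight a i j * (p j (informationTime G T τ i j t) c -
        informationTime G T τ i j t * vd c) := by
  have h1 : t * vd c = ∑ j, averagingWeight a i j * (t * vd c) := by
    rw [← Finset.sum_mul, sum_averagingWeight, one_mul]
  have h2 : ((1 / kappa a i) • ∑ j, a i j • posEstimate T (τ j i) vd (init i j) (p j) t) c =
      ∑ j, averagingWeight a i j * posEstimate T (τ j i) vd (init i j) (p j) t c := by
    simp only [PiLp.smul_apply, smul_eq_mul, WithLp.ofLp_sum, Finset.sum_apply, WithLp.ofLp_smul,
      Pi.smul_apply, Finset.mul_sum, averagingWeight, ne_eq, hi, not_false_eq_true, if_true]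
    exact Finset.sum_congr rfl fun j _ => by ring
  rw [h2, h1, ← Finset.sum_sub_distrib]
  refine Finset.sum_congr rfl fun j _ => ?_
  rw [← mul_sub]
  by_cases hadj : G.Adj j i
  · obtain ⟨K, hK, hK0, hgap, hτ⟩ := hcomm j i hadj
    have hne := (lastIndex_mul_mem_Icc hT hh hK hK0 hgap hτ ht).1
    simp only [posEstimate, informationTime, hne, hadj, if_true, PiLp.add_apply, PiLp.smul_apply,
      smul_eq_mul]
    ring
  · simp [averagingWeight, hi, ha.zero i j hadj]

/-! ### The closed loop -/

theorem norm_le_sum_abs {m : ℕ} (x : Vec m) : ‖x‖ ≤ ∑ c, |x c| := by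
  rw [EuclideanSpace.norm_eq]
  refine Real.sqrt_le_iff.2 ⟨Finset.sum_nonneg fun c _ => abs_nonneg _, ?_⟩
  simp only [Real.norm_eq_abs]
  exact Finset.sum_sq_le_sq_sum_of_nonneg fun c _ => abs_nonneg _

theorem norm_le_of_forall_abs_le {m : ℕ} {x : Vec m} {b : ℝ} (h : ∀ c, |x c| ≤ b) :
    ‖x‖ ≤ m * b := by
  refine (norm_le_sum_abs x).trans ((Finset.sum_le_sum fun c _ => h c).trans ?_)
  simp

theorem abs_apply_le_norm {m : ℕ} (x : Vec m) (c : Fin m) : |x c| ≤ ‖x‖ := by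
  simpa using PiLp.norm_apply_le x c

theorem MultiAgent.SolvesODE.apply {m : ℕ} {x f : ℝ → Vec m} (hx : SolvesODE x f) (c : Fin m) :
    SolvesODE (fun t => x t c) (fun t => f t c) :=
  hx.clm_comp (EuclideanSpace.proj c : Vec m →L[ℝ] ℝ)

theorem solvesODE_mul_const (b : ℝ) : SolvesODE (fun t => t * b) (fun _ => b) := fun t _ =>
  ⟨intervalIntegrable_const, by simp⟩

theorem boundedForward_of_eventually {E : Type*} [NormedAddCommGroup E] {x : ℝ → E} {b : ℝ}
    (hx : ContinuousOn x (Ici 0)) (h : ∀ᶠ t in atTop, ‖x t‖ ≤ b) : BoundedForward x := by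
  obtain ⟨T₀, hT₀⟩ := eventually_atTop.1 h
  obtain ⟨b', hb'⟩ := (isCompact_Icc (a := 0) (b := T₀)).bddAbove_image
    ((hx.mono Icc_subset_Ici_self).norm)
  refine ⟨max b b', fun t ht => ?_⟩
  rcases le_total t T₀ with h1 | h1
  · exact (hb' (mem_image_of_mem _ ⟨ht, h1⟩)).trans (le_max_right _ _)
  · exact (hT₀ t h1).trans (le_max_left _ _)

namespace MultiAgent.IsNetworkTrajectory

variable {n m : ℕ} {F : Fin n → Vec m → Vec m → Vec m → Vec m} {G : Digraph (Fin n)}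
  {a : Fin n → Fin n → ℝ} {T : ℝ} {τ : Fin n → Fin n → ℕ → ℝ≥0∞} {kstar : ℕ} {h : ℝ}
  {law : Fin n → TrackingLaw m} {k lam : Fin n → ℝ} {vd : Vec m}
  {init : Fin n → Fin n → ℝ → Vec m} {p v η ψ : Fin n → ℝ → Vec m}
  {ξ : (i : Fin n) → ℝ → Vec (law i).q}

theorem continuousOn_etaRate
    (htraj : IsNetworkTrajectory F law a T τ k lam vd init p v η ψ ξ) (i : Fin n) :
    ContinuousOn (etaRate a k lam p η ψ i) (Ici 0) := by
  by_cases hi : kappa a i = 0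
  · have : etaRate a k lam p η ψ i = fun _ => 0 := by
      funext t
      simp [etaRate, hi]
    rw [this]
    exact continuousOn_const
  · have : etaRate a k lam p η ψ i =
        fun t => -(k i • η i t) - lam i • (p i t - ψ i t) := by
      funext t
      simp [etaRate, hi]
    rw [this]
    have h1 : ContinuousOn (η i) (Ici 0) := (htraj.eta i hi).continuousOn
    have h2 : ContinuousOn (p i) (Ici 0) := (htraj.agent i).position.continuousOn
    have h3 : ContinuousOn (ψ i) (Ici 0) := (htraj.psi i hi).continuousOn
    fun_prop

theorem continuousOn_eta
    (htraj : IsNetworkTrajectory F law a T τ k lam vd init p v η ψ ξ) (i : Fin n) :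
    ContinuousOn (η i) (Ici 0) := by
  by_cases hi : kappa a i = 0
  · exact continuousOn_const.congr fun t ht => htraj.eta_zero i hi t ht
  · exact (htraj.eta i hi).continuousOn

theorem isC1Reference
    (htraj : IsNetworkTrajectory F law a T τ k lam vd init p v η ψ ξ) (i : Fin n) :
    IsC1Reference (fun t => η i t + vd) (etaRate a k lam p η ψ i) := by
  refine ⟨fun t ht => ?_, htraj.continuousOn_etaRate i⟩
  refine HasDerivWithinAt.add_const _ ?_
  by_cases hi : kappa a i = 0
  · have : etaRate a k lam p η ψ i t = 0 := by simp [etaRate, hi]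
    rw [this]
    exact (hasDerivWithinAt_const t (Ici 0) (0 : Vec m)).congr
      (fun s hs => htraj.eta_zero i hi s hs) (htraj.eta_zero i hi t ht)
  · have hη := htraj.eta i hi
    have hcont := htraj.continuousOn_etaRate i
    set f := etaRate a k lam p η ψ i with hf
    -- extend the rate continuously to the left of `0`
    have hcont' : Continuous (fun s => f (max s 0)) :=
      hcont.comp_continuous (by fun_prop) fun s => mem_Ici.2 (le_max_right _ _)
    have hd := (intervalIntegral.integral_hasDerivAt_right
      (hcont'.intervalIntegrable 0 t) (hcont'.stronglyMeasurableAtFilter _ _) hcont'.continuousAt)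
    rw [max_eq_left ht] at hd
    have heq : ∀ s, 0 ≤ s → η i s = η i 0 + ∫ x in (0 : ℝ)..s, f (max x 0) := fun s hs => by
      rw [(hη s hs).2]
      congr 1
      refine intervalIntegral.integral_congr fun x hx => ?_
      rw [uIcc_of_le hs] at hx
      simp only [max_eq_left hx.1]
    exact ((hd.const_add (η i 0)).hasDerivWithinAt).congr (fun s hs => heq s hs) (heq t ht)

/-- The states of the synchronization filters and the disagreement of the positions are eventually
bounded by a fixed multiple of the tracking errors. -/
theorem exists_gain (ha : IsWeightedAdjacency G a) (hT : 0 < T) (hh : 0 ≤ h)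
    (hcomm : CommunicationAssumption G τ kstar h)
    (hgain : ∀ i, kappa a i ≠ 0 → 1 + 2 * (kstar * T + h) < rootMargin (k i) (lam i))
    (htree : HasSpanningTree G)
    (htraj : IsNetworkTrajectory F law a T τ k lam vd init p v η ψ ξ) :
    ∃ C, 0 < C ∧ ∀ ε, 0 < ε → (∀ᶠ t in atTop, ∀ i, ‖v i t - (η i t + vd)‖ ≤ ε) →
      ∀ᶠ t in atTop, (∀ i j, ‖p i t - p j t‖ ≤ C * ε) ∧
        ∀ i, ‖η i t‖ ≤ C * ε ∧ (kappa a i ≠ 0 → ‖p i t - ψ i t‖ ≤ C * ε) := by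
  classical
  obtain ⟨r, hr⟩ := htree
  have hH : 0 ≤ kstar * T + h := by positivity
  have hgains : ∀ i, kappa a i ≠ 0 → 2 < k i ∧ k i - 1 < lam i := fun i hi =>
    gains_of_one_lt_rootMargin (by linarith [hgain i hi])
  have hpath : ∀ i, Relation.ReflTransGen (fun j i => 0 < averagingWeight a i j) r i := fun i =>
    Relation.ReflTransGen.mono (fun j i (hji : G.Adj j i) => by
      have hi := ha.kappa_ne_zero hji
      simp only [averagingWeight, ne_eq, hi, not_false_eq_true, if_true]
      exact div_pos (ha.pos i j hji) ((ha.kappa_nonneg i).lt_of_ne' hi)) r i (hr i)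
  -- only an agent without incoming links has a self-loop, and it uses its current position
  have hself : ∀ (i : Fin n) (t : ℝ), kappa a i = 0 → informationTime G T τ i i t = t :=
    fun i t hi => by
      simp only [informationTime]
      rw [if_neg fun hadj => ha.kappa_ne_zero hadj hi]
  obtain ⟨C, hC, hmain⟩ := exists_synchronization_gain hH (averagingWeight_nonneg ha)
    (sum_averagingWeight a) (informationTime_mem_Icc hT hh hcomm) hpath
    (fun i => kappa a i ≠ 0) k lam (fun i hi => (hgains i hi).1) (fun i hi => (hgains i hi).2)
  refine ⟨m * C + 1, by positivity, fun ε hε hev => ?_⟩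
  have hcoord : ∀ c : Fin m, ∀ᶠ t in atTop, (∀ i j, |(p i t - p j t) c| ≤ C * ε) ∧
      ∀ i, kappa a i ≠ 0 → |η i t c| ≤ C * ε ∧ |(p i t - ψ i t) c| ≤ C * ε := fun c => by
    set q : Fin n → ℝ → ℝ := fun i t => p i t c - t * vd c with hq
    set φ : Fin n → ℝ → ℝ := fun i t => ψ i t c - t * vd c with hφ
    set u : Fin n → ℝ → ℝ := fun i t => if kappa a i ≠ 0 then
      ((1 / kappa a i) • ∑ j, a i j • posEstimate T (τ j i) vd (init i j) (p j) t) c - t * vd c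
      else q i t with hu
    have hqode : ∀ i, SolvesODE (q i) (fun t => η i t c + (v i t - (η i t + vd)) c) := fun i =>
      (((htraj.agent i).position.apply c).sub (solvesODE_mul_const (vd c))).congr
        (fun _ _ => rfl) fun t _ => by
          simp only [PiLp.sub_apply, PiLp.add_apply]
          ring
    have := hmain q (fun i t => η i t c) φ (fun i t => (v i t - (η i t + vd)) c) u
      (fun i hi => ⟨hqode i, ?_, ?_⟩) (fun i hi => ⟨?_, ?_⟩) (fun i t ht => ?_) ε hε ?_
    · filter_upwards [this] with t ht
      refine ⟨fun i j => ?_, fun i hi => ⟨(ht.2 i hi).1, ?_⟩⟩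
      · have h1 := ht.1 i j
        have h2 : q i t - q j t = (p i t - p j t) c := by
          simp only [hq, PiLp.sub_apply]
          ring
        rwa [h2] at h1
      · have h1 := (ht.2 i hi).2
        have h2 : q i t - φ i t = (p i t - ψ i t) c := by
          simp only [hq, hφ, PiLp.sub_apply]
          ring
        rwa [h2] at h1
    · refine ((htraj.eta i hi).apply c).congr (fun _ _ => rfl) fun t _ => ?_
      simp only [etaRate, ne_eq, hi, not_false_eq_true, if_true, hq, hφ, PiLp.sub_apply,
        PiLp.neg_apply, PiLp.smul_apply, smul_eq_mul]
      ring
    · refine (((htraj.psi i hi).apply c).sub (solvesODE_mul_const (vd c))).congr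
        (fun _ _ => rfl) fun t _ => ?_
      simp only [hu, hφ, ne_eq, hi, not_false_eq_true, if_true, PiLp.add_apply, PiLp.neg_apply]
      ring
    · refine (hqode i).congr (fun _ _ => rfl) fun t ht => ?_
      rw [htraj.eta_zero i (not_not.1 hi) t ht]
      simp
    · funext t
      simp only [hu, if_neg hi]
    · by_cases hi : kappa a i = 0
      · simp [hu, averagingWeight, hi, hself i t hi]
      · have hi' : kappa a i ≠ 0 := hi
        simp only [hu, if_pos hi']
        exact average_posEstimate ha hT hh hcomm vd init p hi c ht
    · filter_upwards [hev] with t ht i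
      exact (abs_apply_le_norm _ c).trans (ht i)
  filter_upwards [eventually_all.2 hcoord, eventually_ge_atTop 0] with t ht ht0
  have hle : m * (C * ε) ≤ (m * C + 1) * ε := by linarith
  have hpos : 0 ≤ (m * C + 1) * ε := by positivity
  refine ⟨fun i j => (norm_le_of_forall_abs_le fun c => (ht c).1 i j).trans hle, fun i => ⟨?_,
    fun hi => (norm_le_of_forall_abs_le fun c => ((ht c).2 i hi).2).trans hle⟩⟩
  by_cases hi : kappa a i = 0
  · rw [htraj.eta_zero i hi t ht0, norm_zero]
    exact hpos
  · exact (norm_le_of_forall_abs_le fun c => ((ht c).2 i hi).1).trans hle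

end MultiAgent.IsNetworkTrajectory

end

theorem corollary1 {n m : ℕ}
    -- the agents `ṗ_i = v_i`, `v̇_i = F_i(p_i, v_i, u_i)`
    (F : Fin n → MultiAgent.Vec m → MultiAgent.Vec m → MultiAgent.Vec m → MultiAgent.Vec m)
    (hF : ∀ i, LocallyLipschitz (fun x : MultiAgent.Vec m × MultiAgent.Vec m × MultiAgent.Vec m =>
      F i x.1 x.2.1 x.2.2))
    -- the interconnection graph and its weights
    (G : Digraph (Fin n)) (a : Fin n → Fin n → ℝ) (ha : MultiAgent.IsWeightedAdjacency G a)
    -- the communication process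
    (T : ℝ) (hT : 0 < T) (τ : Fin n → Fin n → ℕ → ℝ≥0∞) (kstar : ℕ) (h : ℝ) (hh : 0 ≤ h)
    (hcomm : MultiAgent.CommunicationAssumption G τ kstar h)
    -- the control laws
    (law : Fin n → MultiAgent.TrackingLaw m) (hlaw : ∀ i, (law i).Tracks (F i))
    -- the gains
    (k lam : Fin n → ℝ) (hk : ∀ i, MultiAgent.kappa a i ≠ 0 → 0 < k i)
    (hlam : ∀ i, MultiAgent.kappa a i ≠ 0 → 0 < lam i)
    (hgain : ∀ i, MultiAgent.kappa a i ≠ 0 →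
      1 + 2 * (kstar * T + h) < MultiAgent.rootMargin (k i) (lam i))
    -- the desired velocity, the estimates used before the first message, and a trajectory
    (vd : MultiAgent.Vec m) (init : Fin n → Fin n → ℝ → MultiAgent.Vec m)
    (p v η ψ : Fin n → ℝ → MultiAgent.Vec m) (ξ : (i : Fin n) → ℝ → MultiAgent.Vec (law i).q)
    (htraj : MultiAgent.IsNetworkTrajectory F law a T τ k lam vd init p v η ψ ξ)
    -- the graph contains a spanning tree
    (htree : MultiAgent.HasSpanningTree G) :
    (∀ i, Tendsto (v i) atTop (𝓝 vd)) ∧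
      ∀ i j, Tendsto (fun t => p i t - p j t) atTop (𝓝 0) := by
  obtain ⟨C, hC, hmain⟩ := htraj.exists_gain ha hT hh hcomm hgain htree
  have hn : Nonempty (Fin n) := let ⟨r, _⟩ := htree; ⟨r⟩
  have htrack := fun i => hlaw i _ _ (htraj.isC1Reference i) _ _ _ (htraj.agent i)
  -- bounded tracking errors make the reference velocities and their derivatives bounded
  have hbdd : ∀ i, MultiAgent.BoundedForward (fun t => η i t + vd) ∧
      MultiAgent.BoundedForward (MultiAgent.etaRate a k lam p η ψ i) := by
    choose B hB using fun i => (htrack i).1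
    obtain ⟨i₀, hi₀⟩ := Finite.exists_max B
    have hev := hmain (max (B i₀) 1) (lt_max_of_lt_right one_pos)
      ((eventually_ge_atTop 0).mono fun t ht i =>
        (hB i t ht).trans ((hi₀ i).trans (le_max_left _ _)))
    set b := C * max (B i₀) 1 with hb
    refine fun i => ⟨boundedForward_of_eventually (b := b + ‖vd‖)
      ((htraj.continuousOn_eta i).add continuousOn_const) ?_, boundedForward_of_eventually
      (b := |k i| * b + |lam i| * b) (htraj.continuousOn_etaRate i) ?_⟩
    · filter_upwards [hev] with t ht
      exact (norm_add_le _ _).trans (by linarith [(ht.2 i).1])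
    · filter_upwards [hev] with t ht
      have hb0 : 0 ≤ b := (norm_nonneg _).trans (ht.2 i).1
      by_cases hi : MultiAgent.kappa a i = 0
      · simp only [MultiAgent.etaRate, hi, ne_eq, not_true_eq_false, if_false, norm_zero]
        positivity
      · simp only [MultiAgent.etaRate, hi, ne_eq, not_false_eq_true, if_true]
        refine (norm_sub_le _ _).trans ?_
        rw [norm_neg, norm_smul, norm_smul, Real.norm_eq_abs, Real.norm_eq_abs]
        gcongr
        · exact (ht.2 i).1
        · exact (ht.2 i).2 hi
  have herr : ∀ i, Tendsto (fun t => v i t - (η i t + vd)) atTop (𝓝 0) := fun i =>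
    (htrack i).2 (hbdd i).1 (hbdd i).2
  have hsmall : ∀ ε, 0 < ε → ∀ᶠ t in atTop, ∀ i, ‖v i t - (η i t + vd)‖ ≤ ε := fun ε hε =>
    eventually_all.2 fun i => by
      have := (tendsto_zero_iff_norm_tendsto_zero.1 (herr i)).eventually_le_const hε
      exact this
  refine ⟨fun i => ?_, fun i j => ?_⟩
  · have hη : Tendsto (η i) atTop (𝓝 0) := by
      refine Metric.tendsto_nhds.2 fun δ hδ => ?_
      have hε : 0 < δ / (2 * C) := by positivity
      filter_upwards [hmain _ hε (hsmall _ hε)] with t ht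
      rw [dist_zero_right]
      have h1 : C * (δ / (2 * C)) = δ / 2 := by field_simp
      linarith [(ht.2 i).1]
    have hsum := ((herr i).add hη).add_const vd
    simp only [zero_add] at hsum
    exact hsum.congr fun t => by abel
  · refine Metric.tendsto_nhds.2 fun δ hδ => ?_
    have hε : 0 < δ / (2 * C) := by positivity
    filter_upwards [hmain _ hε (hsmall _ hε)] with t ht
    rw [dist_zero_right]
    have h1 : C * (δ / (2 * C)) = δ / 2 := by field_simp
    linarith [ht.1 i j]
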